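/- **Conventions.** A half-integer is an element of $\frac12+\mathbb Z$. An $n$-partition (respectively $n$-half-partition) is a vector $\lambda_1\ge\dots\ge\lambda_n\ge 0$ of integers (respectively of half-integers). We write $u^{(k)}=(u,\dots,u)$ ($k$ entries). A sum over $\lambda\subseteq u^{(m)}$ runs over all $m$-partitions (if $u\in\mathbb Z$) or all $m$-half-partitions (if $u\in\frac12+\mathbb Z$) with all $\lambda_i\le u$; $(u^{(n-m)},\lambda)$ denotes concatenation. A *half-triangular array* of height $N$ is $z=(z_{i,j})_{1\le i\le N,\,1\le j\le\lceil i/2\rceil}$; it is *interlacing* if $z_{i+1,j+1}\le z_{i,j}\le z_{i+1,j}$ whenever the entries involved exist. Its shape is its bottom row, and $\mathrm{type}(z)_i=\sum_{j}z_{i,j}-\sum_j z_{i-1,j}$ (with an empty $0$-th row). A *symplectic pattern* is an interlacing half-triangular array with entries in $\mathbb Z_{\ge0}$; $\mathrm{spGT}^{(N)}_\lambda$ is the set of those of height $N$ and shape $\lambda$. A *split orthogonal pattern* of height $2n$ is an interlacing half-triangular array whose odd ends $z_{2i-1,i}$ ($1\le i\le n$) lie in $\frac12\mathbb Z_{\ge0}$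 and whose other entries are either all in $\mathbb Z_{\ge0}$ or all in $\frac12+\mathbb Z_{\ge0}$; $\mathrm{soGT}^{(2n)}_\lambda$ is the set of those of shape $\lambda$. If $z_{2n,1}$ is an integer (respectively a half-integer), the half-integer (respectively integer) entries of $z$ are called atypical, and $|\mathrm{atyp}(z)|$ is their number. For $x=(x_1,\dots,x_n)$, with $w_z(x)=\prod_{i=1}^n x_i^{\mathrm{type}(z)_{2i}-\mathrm{type}(z)_{2i-1}}$, put $$\mathrm{trans}_\lambda(x;\beta)=\sum_{z\in\mathrm{soGT}^{(2n)}_\lambda}\beta^{|\mathrm{atyp}(z)|}w_z(x),\qquad \mathrm{so}^{(2n+1)}_\lambda(x)=\sum_{z\in\mathrm{soGT}^{(2n)}_\lambda}w_z(x),$$ $$\mathrm{sp}^{(2n)}_\lambda(x)=\sum_{z\in\mathrm{spGT}^{(2n)}_\lambda}w_z(x),\qquad \mathrm{sp}^{(2n+1)}_\lambda(x;s)=\sum_{z\in\mathrm{spGT}^{(2n+1)}_\lambda}w_z(x)\,s^{\mathrm{type}(z)_{2n+1}}.$$ These are Laurent polynomials in (the square roots of) the variables over a commutative ring containing $\beta$;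 $\mathrm{trans}_\lambda$ is the $\mathrm{CB}$-interpolating Schur polynomial, and the others are the odd orthogonal, even symplectic and odd symplectic Schur polynomials. **Theorem.** Let $n\ge m\ge1$ be integers, $x=(x_1,\dots,x_n)$, $y=(y_1,\dots,y_m)$, and let $s$ be one further variable. Then $$\mathrm{trans}_{u^{(n+m)}}(x,y;\beta)=\sum_{\lambda\subseteq u^{(m)}}\mathrm{trans}_{(u^{(n-m)},\lambda)}(x;\beta)\,\mathrm{trans}_\lambda(y;\beta),\qquad u\in\tfrac12\mathbb Z_{\ge0}.$$ In particular, for $\beta=0$ and $\beta=1$, $$\mathrm{sp}^{(2n+2m)}_{u^{(n+m)}}(x,y)=\sum_{\lambda\subseteq u^{(m)}}\mathrm{sp}^{(2n)}_{(u^{(n-m)},\lambda)}(x)\,\mathrm{sp}^{(2m)}_\lambda(y),\qquad u\in\mathbb Z_{\ge0},$$ $$\mathrm{so}^{(2n+2m+1)}_{u^{(n+m)}}(x,y)=\sum_{\lambda\subseteq u^{(m)}}\mathrm{so}^{(2n+1)}_{(u^{(n-m)},\lambda)}(x)\,\mathrm{so}^{(2m+1)}_\lambda(y),\qquad u\in\tfrac12\mathbb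 Z_{\ge0}.$$ Moreover, $$\mathrm{sp}^{(2n+2m+2)}_{u^{(n+m+1)}}(x,y,s)=s^{-u}\sum_{\lambda\subseteq u^{(m+1)}}\mathrm{sp}^{(2n+1)}_{(u^{(n-m)},\lambda)}(x;s)\,\mathrm{sp}^{(2m+1)}_\lambda(y;s),\qquad u\in\mathbb Z_{\ge0}.$$ -/

import Mathlib

open scoped BigOperators

noncomputable section

namespace CBSchur

/-! ### Integers, half-integers and (half-)partitions -/

/-- `q` is a non-negative integer. -/
def IsNonnegInt (q : ℚ) : Prop := ∃ k : ℕ, q = k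

/-- `q` is a non-negative half-integer, that is, `q ∈ 1/2 + ℤ_{≥ 0}`. -/
def IsNonnegHalfInt (q : ℚ) : Prop := ∃ k : ℕ, q = k + 1 / 2

/-- `q ∈ (1/2) ℤ_{≥ 0}`. -/
def IsHalfNat (q : ℚ) : Prop := ∃ k : ℕ, q = k / 2

/-- `n`-partitions: weakly decreasing vectors of `n` non-negative integers. -/
def IsPartition {n : ℕ} (lam : Fin n → ℚ) : Prop :=
  Antitone lam ∧ ∀ i, IsNonnegInt (lam i)

/-- `n`-half-partitions: weakly decreasing vectors of `n` non-negative half-integers. -/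
def IsHalfPartition {n : ℕ} (lam : Fin n → ℚ) : Prop :=
  Antitone lam ∧ ∀ i, IsNonnegHalfInt (lam i)

/-- The index set of a sum over `lam ⊆ mu`: all partitions (respectively, half-partitions) `lam`
with `lam_i ≤ mu_i` for all `i`, if `mu` is a partition (respectively, a half-partition). -/
def subPartitions {n : ℕ} (mu : Fin n → ℚ) : Set (Fin n → ℚ) :=
  {lam | ((IsPartition mu ∧ IsPartition lam) ∨ (IsHalfPartition mu ∧ IsHalfPartition lam)) ∧
    ∀ i, lam i ≤ mu i}

/-- The vector `u^{(n)} = (u, …, u)` with `n` components. -/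
def rect (n : ℕ) (u : ℚ) : Fin n → ℚ := fun _ => u

/-- The vector `(u^{(k)}, lam)`, of length `n = k + l`. -/
def prependRect {k l n : ℕ} (h : n = k + l) (u : ℚ) (lam : Fin l → ℚ) : Fin n → ℚ :=
  fun i => Fin.append (rect k u) lam (Fin.cast h i)

/-! ### Half-triangular patterns

A half-triangular array `(z_{i,j})`, `1 ≤ i ≤ N`, `1 ≤ j ≤ ⌈i/2⌉`, is represented by a function
`z : ℕ → ℕ → ℚ` which vanishes outside these indices. -/

/-- The index set of half-triangular arrays of height `N`; here `(i + 1) / 2 = ⌈i/2⌉`. -/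
def Idx (N i j : ℕ) : Prop := 1 ≤ i ∧ i ≤ N ∧ 1 ≤ j ∧ j ≤ (i + 1) / 2

/-- The array `z` has no entries outside the index set. -/
def IsArray (N : ℕ) (z : ℕ → ℕ → ℚ) : Prop := ∀ i j, ¬ Idx N i j → z i j = 0

/-- The interlacing conditions `z_{i+1,j+1} ≤ z_{i,j} ≤ z_{i+1,j}`, whenever both entries of the
inequality belong to the array. -/
def Interlacing (N : ℕ) (z : ℕ → ℕ → ℚ) : Prop :=
  (∀ i j, Idx N i j → Idx N (i + 1) j → z i j ≤ z (i + 1) j) ∧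
  (∀ i j, Idx N i j → Idx N (i + 1) (j + 1) → z (i + 1) (j + 1) ≤ z i j)

/-- The shape (bottom row) of the array `z` of height `N` is `lam`, where `l = ⌈N/2⌉`. -/
def HasShape (N : ℕ) {l : ℕ} (lam : Fin l → ℚ) (z : ℕ → ℕ → ℚ) : Prop :=
  ∀ j : Fin l, z N (j + 1) = lam j

/-- The sum of the `i`-th row. -/
def rowSum (z : ℕ → ℕ → ℚ) (i : ℕ) : ℚ := ∑ j ∈ Finset.Icc 1 ((i + 1) / 2), z i j

/-- The `i`-th entry of the type of `z`, for `i ≥ 1`. -/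
def rowType (z : ℕ → ℕ → ℚ) (i : ℕ) : ℚ := rowSum z i - rowSum z (i - 1)

/-- Symplectic patterns of height `N` and shape `lam`, where `l = ⌈N/2⌉`. -/
def spGT (N : ℕ) {l : ℕ} (lam : Fin l → ℚ) : Set (ℕ → ℕ → ℚ) :=
  {z | IsArray N z ∧ (∀ i j, Idx N i j → IsNonnegInt (z i j)) ∧ Interlacing N z ∧
    HasShape N lam z}

/-- `(i, j)` is the position of an odd end, that is, `(i, j) = (2 k - 1, k)` for some `k`. -/
def IsOddEnd (i j : ℕ) : Prop := i + 1 = 2 * j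

/-- Split orthogonal patterns of height `2 n` and shape `lam`. -/
def soGT (n : ℕ) (lam : Fin n → ℚ) : Set (ℕ → ℕ → ℚ) :=
  {z | IsArray (2 * n) z ∧
    (∀ i j, Idx (2 * n) i j → IsOddEnd i j → IsHalfNat (z i j)) ∧
    ((∀ i j, Idx (2 * n) i j → ¬ IsOddEnd i j → IsNonnegInt (z i j)) ∨
      (∀ i j, Idx (2 * n) i j → ¬ IsOddEnd i j → IsNonnegHalfInt (z i j))) ∧
    Interlacing (2 * n) z ∧ HasShape (2 * n) lam z}

/-- The entry `z_{i,j}` is atypical: it is a half-integer while `z_{2n,1}` is an integer, or it is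
an integer while `z_{2n,1}` is a half-integer. -/
def IsAtypical (n : ℕ) (z : ℕ → ℕ → ℚ) (i j : ℕ) : Prop :=
  (IsNonnegInt (z (2 * n) 1) ∧ IsNonnegHalfInt (z i j)) ∨
    (IsNonnegHalfInt (z (2 * n) 1) ∧ IsNonnegInt (z i j))

open Classical in
/-- The number of atypical entries; in a split orthogonal pattern only odd ends
`z_{2k-1,k}`, `1 ≤ k ≤ n`, can be atypical. -/
def atypCount (n : ℕ) (z : ℕ → ℕ → ℚ) : ℕ :=
  ((Finset.Icc 1 n).filter fun k => IsAtypical n z (2 * k - 1) k).card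

/-! ### Finiteness of the index sets of the sums -/

theorem finite_of_bounded (N K : ℕ) (S : Set (ℕ → ℕ → ℚ))
    (h : ∀ z ∈ S, IsArray N z ∧ ∀ i j, Idx N i j → ∃ k : ℕ, k < K ∧ z i j = k / 2) :
    S.Finite := by
  classical
  refine (Set.finite_range (fun (f : Fin (N + 1) → Fin (N + 2) → Fin (K + 1)) (i j : ℕ) =>
    if hij : i < N + 1 ∧ j < N + 2 then (((f ⟨i, hij.1⟩ ⟨j, hij.2⟩ : ℕ) : ℚ) / 2) else 0)).subset ?_
  intro z hz
  obtain ⟨h0, h1⟩ := h z hz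
  have h2 : ∀ i j, ∃ k : ℕ, k < K + 1 ∧ z i j = k / 2 := by
    intro i j
    by_cases hi : Idx N i j
    · obtain ⟨k, hk, e⟩ := h1 i j hi
      exact ⟨k, by omega, e⟩
    · exact ⟨0, by omega, by simp [h0 i j hi]⟩
  choose f hf1 hf2 using h2
  refine ⟨fun i j => ⟨f i j, hf1 i j⟩, ?_⟩
  funext i j
  by_cases hij : i < N + 1 ∧ j < N + 2
  · simp [hij, hf2 i j]
  · have : ¬ Idx N i j := by
      intro hh
      unfold Idx at hh
      omega
    simp only [dif_neg hij, h0 i j this]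

theorem entry_le_shape {N : ℕ} {z : ℕ → ℕ → ℚ} (h : Interlacing N z) {i j : ℕ}
    (hi : Idx N i j) : z i j ≤ z N j := by
  have key : ∀ d, i + d ≤ N → z i j ≤ z (i + d) j := by
    intro d
    induction d with
    | zero => intro _; exact le_rfl
    | succ d ih =>
      intro hd
      refine (ih (by omega)).trans (h.1 (i + d) j ?_ ?_)
      · unfold Idx at hi ⊢; omega
      · unfold Idx at hi ⊢; omega
  have := key (N - i) (by unfold Idx at hi; omega)
  rwa [Nat.add_sub_cancel' hi.2.1] at this

theorem finite_patterns (N : ℕ) {l : ℕ} (hl : (N + 1) / 2 = l) (lam : Fin l → ℚ)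
    (S : Set (ℕ → ℕ → ℚ))
    (h : ∀ z ∈ S, IsArray N z ∧ (∀ i j, Idx N i j → IsHalfNat (z i j)) ∧ Interlacing N z ∧
      HasShape N lam z) : S.Finite := by
  obtain ⟨K, hK⟩ : ∃ K : ℕ, ∀ j, 2 * lam j < K := by
    obtain ⟨K, hK⟩ := exists_nat_gt (∑ j, |2 * lam j|)
    refine ⟨K, fun j => lt_of_le_of_lt ((le_abs_self _).trans ?_) hK⟩
    exact Finset.single_le_sum (f := fun j => |2 * lam j|) (fun _ _ => abs_nonneg _)
      (Finset.mem_univ j)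
  refine finite_of_bounded N K S fun z hz => ?_
  obtain ⟨h0, h1, h2, h3⟩ := h z hz
  refine ⟨h0, fun i j hij => ?_⟩
  obtain ⟨k, hk⟩ := h1 i j hij
  refine ⟨k, ?_, hk⟩
  have h4 := entry_le_shape h2 hij
  have hj : j - 1 < l := by unfold Idx at hij; omega
  have h5 := h3 ⟨j - 1, hj⟩
  have h6 : (j - 1) + 1 = j := by unfold Idx at hij; omega
  simp only [h6] at h5
  have h7 := hK ⟨j - 1, hj⟩
  have : (k : ℚ) < K := by linarith
  exact_mod_cast this

theorem IsNonnegInt.isHalfNat {q : ℚ} (h : IsNonnegInt q) : IsHalfNat q := by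
  obtain ⟨k, rfl⟩ := h
  exact ⟨2 * k, by push_cast; ring⟩

theorem IsNonnegHalfInt.isHalfNat {q : ℚ} (h : IsNonnegHalfInt q) : IsHalfNat q := by
  obtain ⟨k, rfl⟩ := h
  exact ⟨2 * k + 1, by push_cast; ring⟩

theorem spGT_finite (N : ℕ) {l : ℕ} (hl : (N + 1) / 2 = l) (lam : Fin l → ℚ) :
    (spGT N lam).Finite :=
  finite_patterns N hl lam _ fun _ hz =>
    ⟨hz.1, fun i j hij => (hz.2.1 i j hij).isHalfNat, hz.2.2.1, hz.2.2.2⟩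

theorem soGT_finite (n : ℕ) (lam : Fin n → ℚ) : (soGT n lam).Finite := by
  refine finite_patterns (2 * n) (by omega) lam _ fun z hz => ?_
  obtain ⟨h0, h1, h2, h3, h4⟩ := hz
  refine ⟨h0, fun i j hij => ?_, h3, h4⟩
  by_cases ho : IsOddEnd i j
  · exact h1 i j hij ho
  · rcases h2 with h2 | h2
    · exact (h2 i j hij ho).isHalfNat
    · exact (h2 i j hij ho).isHalfNat

theorem subPartitions_finite {n : ℕ} (mu : Fin n → ℚ) : (subPartitions mu).Finite := by
  obtain ⟨K, hK⟩ : ∃ K : ℕ, ∀ j, 2 * mu j < K := by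
    obtain ⟨K, hK⟩ := exists_nat_gt (∑ j, |2 * mu j|)
    refine ⟨K, fun j => lt_of_le_of_lt ((le_abs_self _).trans ?_) hK⟩
    exact Finset.single_le_sum (f := fun j => |2 * mu j|) (fun _ _ => abs_nonneg _)
      (Finset.mem_univ j)
  refine (Set.finite_range (fun (f : Fin n → Fin K) (i : Fin n) => ((f i : ℕ) : ℚ) / 2)).subset ?_
  rintro lam ⟨h1, h2⟩
  have h3 : ∀ i, IsHalfNat (lam i) := by
    rcases h1 with h | h
    · exact fun i => (h.2.2 i).isHalfNat
    · exact fun i => (h.2.2 i).isHalfNat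
  choose f hf using h3
  have h4 : ∀ i, f i < K := by
    intro i
    have a := h2 i
    have b := hK i
    have c := hf i
    have : (f i : ℚ) < K := by linarith
    exact_mod_cast this
  exact ⟨fun i => ⟨f i, h4 i⟩, by funext i; simp [hf i]⟩

/-! ### The polynomials

All polynomials live in the ring of finite `R`-linear combinations of formal monomials
`∏_v v^{q_v}`, with variables `v` ranging in `σ` and rational exponents `q_v`; this ring contains
the ring of Laurent polynomials in the variables `v^{1/2}`. -/

/-- Laurent polynomials over `R` in the variables `σ`, with rational exponents. -/
abbrev Poly (R σ : Type*) [CommRing R] := AddMonoidAlgebra R (σ →₀ ℚ)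

section

variable (R : Type*) [CommRing R] {σ : Type*}

/-- The monomial `v ^ q`. -/
def vpow (v : σ) (q : ℚ) : Poly R σ := AddMonoidAlgebra.single (Finsupp.single v q) 1

/-- The monomial `∏_{i=1}^n x_i^{type(z)_{2i} - type(z)_{2i-1}}`. -/
def weight {n : ℕ} (x : Fin n → σ) (z : ℕ → ℕ → ℚ) : Poly R σ :=
  ∏ i : Fin n, vpow R (x i) (rowType z (2 * (i + 1)) - rowType z (2 * (i + 1) - 1))

/-- The `CB`-interpolating Schur polynomial with parameter `β`, in the variables `x`. -/
def transCB {n : ℕ} (lam : Fin n → ℚ) (x : Fin n → σ) (β : R) : Poly R σ :=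
  ∑ᶠ z ∈ soGT n lam, β ^ atypCount n z • weight R x z

/-- The `(2n)`-symplectic Schur polynomial. -/
def spEven {n : ℕ} (lam : Fin n → ℚ) (x : Fin n → σ) : Poly R σ :=
  ∑ᶠ z ∈ spGT (2 * n) lam, weight R x z

/-- The `(2n+1)`-symplectic Schur polynomial. -/
def spOdd {n : ℕ} (lam : Fin (n + 1) → ℚ) (x : Fin n → σ) (y : σ) : Poly R σ :=
  ∑ᶠ z ∈ spGT (2 * n + 1) lam, weight R x z * vpow R y (rowType z (2 * n + 1))

/-- The `(2n+1)`-orthogonal Schur polynomial. -/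
def soOdd {n : ℕ} (lam : Fin n → ℚ) (x : Fin n → σ) : Poly R σ :=
  ∑ᶠ z ∈ soGT n lam, weight R x z

end

end CBSchur

end

/-!
The patterns of a fixed shape are summed by peeling off two rows at a time, which expresses the
generating functions through row-transfer kernels, one for each variable. In a pattern of shape
`(u^{(q+1)}, λ)` the next row up is `(u^{(q)}, κ)`, where `λ` lies above `κ` in the interlacing
order. So a pattern of rectangular shape starts, read upwards from its last row, with a pattern
whose rows grow instead of shrink. Cutting at the row `(u^{(n-m)}, λ)` yields the sum over `λ` of
products, in which the second factor has its variables in reverse order. The order is immaterial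
because kernels of different variables commute, which comes down to a symmetry of geometric sums:
reflecting the interval of summation inverts the variable.
-/

noncomputable section

namespace CBSchur

open Finset

/-! ### Horizontal strips -/

/-- `κ / μ` is a horizontal strip, that is, `κ_0 ≥ μ_0 ≥ κ_1 ≥ μ_1 ≥ ⋯`. Partitions are encoded
as finitely supported functions on `ℕ`, with parts indexed from `0`. -/
def HStrip (μ κ : ℕ →₀ ℕ) : Prop := ∀ j, κ (j + 1) ≤ μ j ∧ μ j ≤ κ j

instance : DecidableRel HStrip := Classical.decRel _

/-- The row `μ` has at most `k` non-zero entries, in the positions `0, …, k - 1`. -/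
def LenLE (k : ℕ) (μ : ℕ →₀ ℕ) : Prop := ∀ j, k ≤ j → μ j = 0

theorem HStrip.le {μ κ : ℕ →₀ ℕ} (h : HStrip μ κ) : μ ≤ κ := fun j => (h j).2

theorem LenLE.mono {μ ν : ℕ →₀ ℕ} {k : ℕ} (h : LenLE k ν) (hμ : μ ≤ ν) : LenLE k μ :=
  fun j hj => Nat.eq_zero_of_le_zero (h j hj ▸ hμ j)

theorem exists_lenLE (ν : ℕ →₀ ℕ) : ∃ L, LenLE L ν :=
  ⟨ν.support.sup id + 1, fun j hj => by
    by_contra h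
    have : j ≤ ν.support.sup id := le_sup (f := id) (Finsupp.mem_support_iff.2 h)
    omega⟩

theorem exists_lenLE_eq {m : ℕ} (a : Fin m → ℕ) :
    ∃ lam, LenLE m lam ∧ ∀ i : Fin m, lam i = a i :=
  ⟨Finsupp.onFinset (range m) (fun j => if hj : j < m then a ⟨j, hj⟩ else 0) fun j hj => by
      by_contra hn
      exact hj (dif_neg (mem_range.not.1 hn)),
    fun _ hj => dif_neg hj.not_gt, fun i => dif_pos i.2⟩

theorem LenLE.degree_eq {μ : ℕ →₀ ℕ} {k : ℕ} (h : LenLE k μ) :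
    μ.degree = ∑ j ∈ range k, μ j :=
  sum_subset (fun j hj => mem_range.2 <| by_contra fun hk =>
    Finsupp.mem_support_iff.1 hj (h j (not_lt.1 hk))) fun _ _ hj => Finsupp.notMem_support_iff.1 hj

theorem LenLE.add_single {k : ℕ} {μ : ℕ →₀ ℕ} (h : LenLE k μ) (a : ℕ) :
    LenLE (k + 1) (μ + Finsupp.single k a) := fun j hj => by
  simp [h j (by omega), show k ≠ j by omega]

theorem LenLE.erase {k : ℕ} {ρ : ℕ →₀ ℕ} (h : LenLE (k + 1) ρ) : LenLE k (ρ.erase k) := by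
  intro j hj
  rcases hj.eq_or_lt with rfl | hj
  · exact Finsupp.erase_same
  · rw [Finsupp.erase_ne hj.ne', h j hj]

open Classical in
/-- The rows contained in `ν` with at most `k` non-zero entries. -/
def rowsUpTo (k : ℕ) (ν : ℕ →₀ ℕ) : Finset (ℕ →₀ ℕ) := (Iic ν).filter (LenLE k)

theorem mem_rowsUpTo {k : ℕ} {ρ ν : ℕ →₀ ℕ} : ρ ∈ rowsUpTo k ν ↔ ρ ≤ ν ∧ LenLE k ρ := by
  classical rw [rowsUpTo, mem_filter, mem_Iic]

/-- The rows with at most `k` non-zero entries which may stand directly above the row `ν` of an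
interlacing array. -/
def rowsAbove (k : ℕ) (ν : ℕ →₀ ℕ) : Finset (ℕ →₀ ℕ) := (rowsUpTo k ν).filter fun κ => HStrip κ ν

theorem mem_rowsAbove {k : ℕ} {κ ν : ℕ →₀ ℕ} : κ ∈ rowsAbove k ν ↔ LenLE k κ ∧ HStrip κ ν := by
  rw [rowsAbove, mem_filter, mem_rowsUpTo]
  exact ⟨fun h => ⟨h.1.2, h.2⟩, fun h => ⟨⟨h.2.le, h.1⟩, h.2⟩⟩

/-- The least value of `κ_j` for `κ` between `μ` and `ν` in the order of horizontal strips. -/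
def loEntry (μ ν : ℕ →₀ ℕ) (j : ℕ) : ℕ := max (μ j) (ν (j + 1))

/-- The largest value of `κ_j` for `κ` between `μ` and `ν` in the order of horizontal strips. -/
def hiEntry (μ ν : ℕ →₀ ℕ) : ℕ → ℕ
  | 0 => ν 0
  | j + 1 => min (ν (j + 1)) (μ j)

theorem hStrip_and_hStrip_iff {μ κ ν : ℕ →₀ ℕ} :
    HStrip μ κ ∧ HStrip κ ν ↔ ∀ j, κ j ∈ Icc (loEntry μ ν j) (hiEntry μ ν j) := by
  simp only [mem_Icc]
  constructor
  · rintro ⟨hμκ, hκν⟩ j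
    refine ⟨max_le (hμκ j).2 (hκν j).1, ?_⟩
    cases j with
    | zero => exact (hκν 0).2
    | succ j => exact le_min (hκν _).2 (hμκ _).1
  · intro h
    refine ⟨fun j => ⟨(h (j + 1)).2.trans (min_le_right _ _), (le_max_left _ _).trans (h j).1⟩,
      fun j => ⟨(le_max_right _ _).trans (h j).1, (h j).2.trans ?_⟩⟩
    cases j with
    | zero => exact le_rfl
    | succ j => exact min_le_left _ _

/- The point is that `loEntry μ ν j` and `hiEntry μ ν (j + 1)` are the maximum and the minimum of
the same two numbers. -/
theorem sum_loEntry_add_hiEntry (μ ν : ℕ →₀ ℕ) (L : ℕ) :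
    ∑ j ∈ range (L + 1), (loEntry μ ν j + hiEntry μ ν j) + min (μ L) (ν (L + 1)) =
      ∑ j ∈ range (L + 1), μ j + ∑ j ∈ range (L + 2), ν j := by
  induction L with
  | zero => simp [sum_range_succ, loEntry, hiEntry]; omega
  | succ L ih =>
    rw [sum_range_succ, sum_range_succ (n := L + 1), sum_range_succ (n := L + 2)]
    simp only [loEntry, hiEntry, Nat.add_assoc, Nat.reduceAdd] at ih ⊢
    omega

theorem LenLE.sum_loEntry_add_hiEntry {μ ν : ℕ →₀ ℕ} {L : ℕ} (hν : LenLE L ν) :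
    ∑ j ∈ range L, (loEntry μ ν j + hiEntry μ ν j) =
      ∑ j ∈ range L, μ j + ∑ j ∈ range L, ν j := by
  cases L with
  | zero => simp
  | succ L =>
    have := CBSchur.sum_loEntry_add_hiEntry μ ν L
    rwa [sum_range_succ (n := L + 1), hν (L + 1) le_rfl, Nat.min_zero] at this

section

variable {A : Type*} [CommRing A]

theorem sum_between_eq_prod {L : ℕ} {μ ν : ℕ →₀ ℕ} (hμ : LenLE L μ) (hν : LenLE L ν) (t : A) :
    ∑ κ ∈ (Icc μ ν).filter (fun κ => HStrip μ κ ∧ HStrip κ ν), t ^ κ.degree =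
      ∏ j ∈ range L, ∑ c ∈ Icc (loEntry μ ν j) (hiEntry μ ν j), t ^ c := by
  rw [prod_range (fun j => ∑ c ∈ Icc (loEntry μ ν j) (hiEntry μ ν j), t ^ c), prod_univ_sum]
  have hlen : ∀ κ ∈ (Icc μ ν).filter (fun κ => HStrip μ κ ∧ HStrip κ ν), LenLE L κ :=
    fun κ hκ => hν.mono (mem_Icc.1 (mem_filter.1 hκ).1).2
  refine sum_bij' (fun κ _ (j : Fin L) => κ j)
    (fun f _ => Finsupp.onFinset (range L) (fun j => if h : j < L then f ⟨j, h⟩ else 0)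
      fun j hj => mem_range.2 (by by_contra h; simp [h] at hj)) ?_ ?_ ?_ ?_ ?_
  · intro κ hκ
    rw [mem_filter, hStrip_and_hStrip_iff] at hκ
    exact Fintype.mem_piFinset.2 fun j => hκ.2 j
  · intro f hf
    suffices hs : ∀ κ, HStrip μ κ ∧ HStrip κ ν →
        κ ∈ (Icc μ ν).filter (fun κ => HStrip μ κ ∧ HStrip κ ν) by
      refine hs _ (hStrip_and_hStrip_iff.2 fun j => ?_)
      rw [Finsupp.onFinset_apply]
      split_ifs with h
      · exact Fintype.mem_piFinset.1 hf ⟨j, h⟩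
      · simp [loEntry, hμ j (by omega), hν (j + 1) (by omega)]
    exact fun κ h => mem_filter.2 ⟨mem_Icc.2 ⟨h.1.le, h.2.le⟩, h⟩
  · intro κ hκ
    ext j
    rw [Finsupp.onFinset_apply]
    split_ifs with h
    · rfl
    · exact (hlen κ hκ j (by omega)).symm
  · intro f _
    ext j
    simp
  · intro κ hκ
    rw [(hlen κ hκ).degree_eq, prod_pow_eq_pow_sum, sum_range]

/-! ### The transfer kernels of one and of two rows -/

/-- The kernel `[κ / μ is a horizontal strip] u^{|κ| - |μ|}`. -/
def stripKernel (u : Aˣ) : IncidenceAlgebra A (ℕ →₀ ℕ) where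
  toFun μ κ := if HStrip μ κ then ((u ^ ((κ.degree : ℤ) - μ.degree) : Aˣ) : A) else 0
  eq_zero_of_not_le' _ _ h := if_neg fun hs => h hs.le

theorem stripKernel_apply (u : Aˣ) (μ κ : ℕ →₀ ℕ) : stripKernel u μ κ =
    if HStrip μ κ then ((u ^ ((κ.degree : ℤ) - μ.degree) : Aˣ) : A) else 0 := rfl

theorem stripKernel_mul_stripKernel (u v : Aˣ) (μ κ ν : ℕ →₀ ℕ) :
    stripKernel u μ κ * stripKernel v κ ν = if HStrip μ κ ∧ HStrip κ ν then
      ((u ^ (-(μ.degree : ℤ)) * v ^ (ν.degree : ℤ) * (u * v⁻¹) ^ κ.degree : Aˣ) : A) else 0 := by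
  rw [stripKernel_apply, stripKernel_apply, ite_and]
  split_ifs
  · rw [← Units.val_mul, ← zpow_natCast (u * v⁻¹), mul_zpow, inv_zpow', mul_mul_mul_comm,
      ← zpow_add, ← zpow_add, neg_add_eq_sub, ← sub_eq_add_neg]
  all_goals simp

theorem stripKernel_mul_apply (u v : Aˣ) {L : ℕ} {μ ν : ℕ →₀ ℕ} (hμ : LenLE L μ)
    (hν : LenLE L ν) : (stripKernel u * stripKernel v) μ ν =
      ((u ^ (-(μ.degree : ℤ)) * v ^ (ν.degree : ℤ) : Aˣ) : A) *
        ∏ j ∈ range L, ∑ c ∈ Icc (loEntry μ ν j) (hiEntry μ ν j), ((u * v⁻¹ : Aˣ) : A) ^ c := by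
  simp_rw [← sum_between_eq_prod hμ hν, IncidenceAlgebra.mul_apply, sum_filter, mul_sum,
    stripKernel_mul_stripKernel, mul_ite, mul_zero, Units.val_mul _ (_ ^ _),
    Units.val_pow_eq_pow_val]

theorem sum_Icc_pow_reflect (t : Aˣ) (a b : ℕ) :
    ∑ c ∈ Icc a b, (t : A) ^ c = (t : A) ^ (a + b) * ∑ c ∈ Icc a b, ((t⁻¹ : Aˣ) : A) ^ c := by
  have hmem : ∀ c ∈ Icc a b, a + b - c ∈ Icc a b := fun c hc => by
    rw [mem_Icc] at hc ⊢
    omega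
  have hinv : ∀ c ∈ Icc a b, a + b - (a + b - c) = c := fun c hc => by
    rw [mem_Icc] at hc
    omega
  rw [mul_sum]
  refine sum_bij' (fun c _ => a + b - c) (fun c _ => a + b - c) hmem hmem hinv hinv fun c hc => ?_
  have hc : c ≤ a + b := by
    rw [mem_Icc] at hc
    omega
  norm_cast
  rw [inv_pow, eq_mul_inv_iff_mul_eq, ← pow_add, Nat.add_sub_cancel' hc]

/- In the product formula for `stripKernel u * stripKernel v`, reflecting each geometric sum about
the middle of its interval exchanges `u` and `v`. -/
theorem stripKernel_commute (u v : Aˣ) : Commute (stripKernel u) (stripKernel v) := by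
  refine IncidenceAlgebra.ext fun μ ν hle => ?_
  obtain ⟨L, hν⟩ := exists_lenLE ν
  have hμ := hν.mono hle
  have hpow : u ^ (-(μ.degree : ℤ)) * v ^ (ν.degree : ℤ) * (u * v⁻¹) ^ (μ.degree + ν.degree) =
      v ^ (-(μ.degree : ℤ)) * u ^ (ν.degree : ℤ) := by
    rw [← zpow_natCast (u * v⁻¹), mul_zpow, inv_zpow', mul_mul_mul_comm, ← zpow_add, ← zpow_add,
      mul_comm]
    push_cast
    congr 2 <;> ring
  rw [stripKernel_mul_apply u v hμ hν, stripKernel_mul_apply v u hμ hν, ← hpow,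
    Units.val_mul _ ((u * v⁻¹) ^ _), mul_assoc, Units.val_pow_eq_pow_val, hμ.degree_eq,
    hν.degree_eq, ← hν.sum_loEntry_add_hiEntry, ← prod_pow_eq_pow_sum, ← prod_mul_distrib]
  simp_rw [sum_Icc_pow_reflect (u * v⁻¹), mul_inv_rev, inv_inv]

/-- The kernel `∑_κ u^{|ν| - 2 |κ| + |μ|}`, where `κ / μ` and `ν / κ` are horizontal strips. -/
def doubleStripKernel (u : Aˣ) : IncidenceAlgebra A (ℕ →₀ ℕ) :=
  stripKernel u⁻¹ * stripKernel u

theorem doubleStripKernel_inv (u : Aˣ) : doubleStripKernel u⁻¹ = doubleStripKernel u := by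
  rw [doubleStripKernel, doubleStripKernel, inv_inv, (stripKernel_commute u u⁻¹).eq]

theorem doubleStripKernel_commute (u v : Aˣ) :
    Commute (doubleStripKernel u) (doubleStripKernel v) :=
  ((stripKernel_commute _ _).mul_right (stripKernel_commute _ _)).mul_left
    ((stripKernel_commute _ _).mul_right (stripKernel_commute _ _))

theorem doubleStripKernel_apply (u : Aˣ) {k : ℕ} (μ : ℕ →₀ ℕ) {ν : ℕ →₀ ℕ} (hν : LenLE k ν) :
    doubleStripKernel u μ ν = ∑ κ ∈ rowsAbove k ν,
      if HStrip μ κ then ((u ^ ((ν.degree : ℤ) - 2 * κ.degree + μ.degree) : Aˣ) : A) else 0 := by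
  rw [doubleStripKernel, IncidenceAlgebra.mul_apply]
  refine sum_congr_of_eq_on_inter ?_ ?_ fun κ _ hκ => ?_
  · intro κ _ hκ
    rw [stripKernel_apply _ κ, if_neg, mul_zero]
    exact fun h => hκ (mem_rowsAbove.2 ⟨hν.mono h.le, h⟩)
  · intro κ hκ hκ'
    exact if_neg fun h => hκ' (mem_Icc.2 ⟨h.le, (mem_rowsAbove.1 hκ).2.le⟩)
  · rw [stripKernel_apply, stripKernel_apply, if_pos (mem_rowsAbove.1 hκ).2, ite_mul, zero_mul,
      ← Units.val_mul, inv_zpow', ← zpow_add, neg_sub, sub_add_sub_comm, two_mul, add_comm]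
    congr 4
    ring

theorem doubleStripKernel_mul_apply (u v : Aˣ) (μ ν : ℕ →₀ ℕ) :
    (doubleStripKernel u * doubleStripKernel v) μ ν =
      ∑ ρ ∈ Iic ν, doubleStripKernel u μ ρ * doubleStripKernel v ρ ν := by
  rw [IncidenceAlgebra.mul_apply]
  refine sum_subset (fun κ hκ => mem_Iic.2 (mem_Icc.1 hκ).2) fun κ hν hκ => ?_
  rw [IncidenceAlgebra.apply_eq_zero_of_not_le, zero_mul]
  exact fun h => hκ (mem_Icc.2 ⟨h, mem_Iic.1 hν⟩)

theorem antitone_of_doubleStripKernel_ne_zero {u : Aˣ} {ρ ν : ℕ →₀ ℕ}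
    (h : doubleStripKernel u ρ ν ≠ 0) : Antitone ρ := by
  obtain ⟨L, hν⟩ := exists_lenLE ν
  rw [doubleStripKernel_apply u ρ hν] at h
  obtain ⟨κ, -, hκ⟩ := exists_ne_zero_of_sum_ne_zero h
  have hstrip : HStrip ρ κ := (ite_ne_right_iff.1 hκ).1
  exact antitone_nat_of_succ_le fun j => (hstrip (j + 1)).2.trans (hstrip j).1

/-- The geometric sum `∑_{a ≤ c ≤ b} u^{-2c}`, which is `0` if `b < a`. -/
def stepSum (u : Aˣ) (a b : ℕ) : A := ∑ c ∈ Icc a b, ((u⁻¹ : Aˣ) : A) ^ (2 * c)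

theorem stepSum_self (u : Aˣ) (a : ℕ) : stepSum u a a = ((u⁻¹ : Aˣ) : A) ^ (2 * a) := by
  simp [stepSum]

theorem stepSum_of_lt (u : Aˣ) {a b : ℕ} (h : b < a) : stepSum u a b = 0 := by
  simp [stepSum, h]

theorem stepSum_eq_add (u : Aˣ) {a b : ℕ} (h : a ≤ b) :
    stepSum u a b = ((u⁻¹ : Aˣ) : A) ^ (2 * a) + stepSum u (a + 1) b := by
  rw [stepSum, ← insert_Icc_add_one_left_eq_Icc h, sum_insert (by simp), stepSum]

theorem sq_mul_stepSum_succ (u : Aˣ) (a b : ℕ) :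
    (u : A) ^ 2 * stepSum u (a + 1) (b + 1) = stepSum u a b := by
  rw [stepSum, stepSum, ← map_add_right_Icc, sum_map, mul_sum]
  refine sum_congr rfl fun c _ => ?_
  rw [addRightEmbedding_apply, mul_add, pow_add, mul_left_comm, mul_one, ← mul_pow, Units.mul_inv,
    one_pow, mul_one]

theorem doubleStripKernel_eq_prod (u : Aˣ) {L : ℕ} {μ ν : ℕ →₀ ℕ} (hμ : LenLE L μ)
    (hν : LenLE L ν) : doubleStripKernel u μ ν =
      (u : A) ^ (μ.degree + ν.degree) *
        ∏ j ∈ range L, stepSum u (loEntry μ ν j) (hiEntry μ ν j) := by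
  rw [doubleStripKernel, stripKernel_mul_apply _ _ hμ hν, inv_zpow', neg_neg, zpow_natCast,
    zpow_natCast, ← pow_add, Units.val_pow_eq_pow_val]
  simp_rw [stepSum, pow_mul, pow_two, Units.val_mul]

end

/-! ### Two-row kernels on rows of bounded length -/

section

variable {A : Type*} [CommRing A]

theorem hiEntry_congr {μ ν μ' ν' : ℕ →₀ ℕ} {j : ℕ} (hν : ν j = ν' j)
    (hμ : ∀ i < j, μ i = μ' i) : hiEntry μ ν j = hiEntry μ' ν' j := by
  cases j with
  | zero => exact hν
  | succ j => simp only [hiEntry, hν, hμ j (Nat.lt_succ_self j)]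

theorem prod_stepSum_congr (u : Aˣ) {k : ℕ} {μ μ' ρ ρ' : ℕ →₀ ℕ} (hμ : ∀ j < k, μ j = μ' j)
    (hρ : ∀ j ≤ k, ρ j = ρ' j) :
    ∏ j ∈ range k, stepSum u (loEntry μ ρ j) (hiEntry μ ρ j) =
      ∏ j ∈ range k, stepSum u (loEntry μ' ρ' j) (hiEntry μ' ρ' j) :=
  prod_congr rfl fun j hj => by
    have hj := mem_range.1 hj
    rw [hiEntry_congr (hρ j hj.le) fun i hi => hμ i (hi.trans hj), loEntry, loEntry, hμ j hj,
      hρ (j + 1) hj]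

theorem doubleStripKernel_add_two (u : Aˣ) {k : ℕ} {μ ρ : ℕ →₀ ℕ} (hμ : LenLE k μ)
    (hρ : LenLE (k + 1) ρ) (a b r : ℕ) :
    doubleStripKernel u (μ + Finsupp.single k a + Finsupp.single (k + 1) b)
        (ρ + Finsupp.single (k + 1) r) =
      (u : A) ^ (μ.degree + ρ.degree) *
        (∏ j ∈ range k, stepSum u (loEntry μ ρ j) (hiEntry μ ρ j)) *
          (u ^ (a + b + r) * (stepSum u (max a r) (hiEntry μ ρ k) * stepSum u b (min r a))) := by
  set μ' := μ + Finsupp.single k a + Finsupp.single (k + 1) b with hμ'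
  set ρ' := ρ + Finsupp.single (k + 1) r with hρ'
  have hμ'_lt : ∀ j < k, μ' j = μ j := fun j hj => by
    simp [hμ', show k ≠ j by omega, show k + 1 ≠ j by omega]
  have hρ'_le : ∀ j ≤ k, ρ' j = ρ j := fun j hj => by simp [hρ', show k + 1 ≠ j by omega]
  have hμ'_k : μ' k = a := by simp [hμ', hμ k le_rfl]
  have hμ'_k1 : μ' (k + 1) = b := by simp [hμ', hμ (k + 1) (by omega)]
  have hρ'_k1 : ρ' (k + 1) = r := by simp [hρ', hρ (k + 1) le_rfl]
  have hρ'_len : LenLE (k + 2) ρ' := hρ.add_single r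
  have hdeg : μ'.degree + ρ'.degree = μ.degree + ρ.degree + (a + b + r) := by
    simp only [hμ', hρ', map_add, Finsupp.degree_single]
    ring
  rw [doubleStripKernel_eq_prod u ((hμ.add_single a).add_single b) hρ'_len, prod_range_succ,
    prod_range_succ, prod_stepSum_congr u hμ'_lt hρ'_le, hdeg, pow_add,
    hiEntry_congr (hρ'_le k le_rfl) hμ'_lt, loEntry, loEntry, hiEntry, hμ'_k, hμ'_k1, hρ'_k1,
    hρ'_len (k + 2) le_rfl, Nat.max_zero]
  ring

theorem doubleStripKernel_add_three (u : Aˣ) {k : ℕ} {μ ρ : ℕ →₀ ℕ} (hμ : LenLE k μ)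
    (hρ : LenLE (k + 1) ρ) (a b c s r : ℕ) :
    doubleStripKernel u
        (μ + Finsupp.single k a + Finsupp.single (k + 1) b + Finsupp.single (k + 2) c)
        (ρ + Finsupp.single (k + 1) s + Finsupp.single (k + 2) r) =
      (u : A) ^ (μ.degree + ρ.degree) *
        (∏ j ∈ range k, stepSum u (loEntry μ ρ j) (hiEntry μ ρ j)) *
          (u ^ (a + b + c + s + r) * (stepSum u (max a s) (hiEntry μ ρ k) *
            stepSum u (max b r) (min s a) * stepSum u c (min r b))) := by
  have hμ_lt : ∀ j < k, (μ + Finsupp.single k a) j = μ j := fun j hj => by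
    simp [show k ≠ j by omega]
  have hρ_le : ∀ j ≤ k, (ρ + Finsupp.single (k + 1) s) j = ρ j := fun j hj => by
    simp [show k + 1 ≠ j by omega]
  rw [doubleStripKernel_add_two u (hμ.add_single a) (hρ.add_single s), prod_range_succ,
    prod_stepSum_congr u hμ_lt hρ_le, hiEntry_congr (hρ_le k le_rfl) hμ_lt, loEntry, hiEntry]
  simp only [Finsupp.add_apply, Finsupp.single_eq_same, hμ k le_rfl, hρ (k + 1) le_rfl, zero_add,
    map_add, Finsupp.degree_single]
  ring

theorem doubleStripKernel_add_succ (u : Aˣ) {k : ℕ} {μ ρ : ℕ →₀ ℕ} (hμ : LenLE k μ)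
    (hρ : LenLE (k + 1) ρ) {a r : ℕ} (b : ℕ) (har : a < r) :
    doubleStripKernel u (μ + Finsupp.single k (a + 1) + Finsupp.single (k + 1) (b + 1))
        (ρ + Finsupp.single (k + 1) r) =
      (doubleStripKernel u (μ + Finsupp.single k a + Finsupp.single (k + 1) b)
        (ρ + Finsupp.single (k + 1) r) : A) := by
  rw [doubleStripKernel_add_two u hμ hρ, doubleStripKernel_add_two u hμ hρ, min_eq_right har.le,
    min_eq_right har, max_eq_right har.le, max_eq_right har, ← sq_mul_stepSum_succ u b a]
  ring

theorem doubleStripKernel_sub_add_one_one (u : Aˣ) {k : ℕ} {μ ρ : ℕ →₀ ℕ} (hμ : LenLE k μ)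
    (hρ : LenLE (k + 1) ρ) (r : ℕ) :
    (doubleStripKernel u μ (ρ + Finsupp.single (k + 1) r) -
        doubleStripKernel u (μ + Finsupp.single k 1 + Finsupp.single (k + 1) 1)
          (ρ + Finsupp.single (k + 1) r) : A) =
      if r = 0 then doubleStripKernel u μ ρ else 0 := by
  rcases r.eq_zero_or_pos with rfl | hr
  · rw [if_pos rfl, doubleStripKernel_add_two u hμ hρ, stepSum_of_lt u (b := min 0 1) (by simp)]
    simp
  · have := doubleStripKernel_add_succ u hμ hρ 0 hr
    simp only [Finsupp.single_zero, add_zero, zero_add] at this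
    rw [if_neg hr.ne', this, sub_self]

theorem doubleStripKernel_add_one_one_sub_add_two_two (u : Aˣ) {k : ℕ} {μ ρ : ℕ →₀ ℕ}
    (hμ : LenLE k μ) (hρ : LenLE (k + 1) ρ) (r : ℕ) :
    (doubleStripKernel u (μ + Finsupp.single k 1 + Finsupp.single (k + 1) 1)
          (ρ + Finsupp.single (k + 1) r) -
        doubleStripKernel u (μ + Finsupp.single k 2 + Finsupp.single (k + 1) 2)
          (ρ + Finsupp.single (k + 1) r) : A) =
      if r = 1 then doubleStripKernel u (μ + Finsupp.single k 1) ρ else 0 := by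
  rcases lt_trichotomy r 1 with hr | rfl | hr
  · obtain rfl : r = 0 := by omega
    rw [if_neg zero_ne_one, doubleStripKernel_add_two u hμ hρ, doubleStripKernel_add_two u hμ hρ,
      stepSum_of_lt u (b := min 0 1) (by simp), stepSum_of_lt u (b := min 0 2) (by simp)]
    simp
  · have hone := doubleStripKernel_add_two u hμ hρ 1 0 0
    simp only [Finsupp.single_zero, add_zero, max_eq_left, zero_le, min_eq_left] at hone
    rw [if_pos rfl, hone, doubleStripKernel_add_two u hμ hρ, doubleStripKernel_add_two u hμ hρ,
      max_self, min_self, ← sq_mul_stepSum_succ u 0 0, stepSum_of_lt u (b := min 1 2) (by simp)]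
    ring
  · rw [if_neg hr.ne', doubleStripKernel_add_succ u hμ hρ 1 hr, sub_self]

theorem doubleStripKernel_add_one_sub_add_two_one (u : Aˣ) {k : ℕ} {μ ρ : ℕ →₀ ℕ}
    (hμ : LenLE k μ) (hρ : LenLE (k + 1) ρ) {r : ℕ}
    (hr : r = 1 → 1 ≤ hiEntry μ ρ k) :
    (doubleStripKernel u (μ + Finsupp.single k 1) (ρ + Finsupp.single (k + 1) r) -
        doubleStripKernel u (μ + Finsupp.single k 2 + Finsupp.single (k + 1) 1)
          (ρ + Finsupp.single (k + 1) r) : A) =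
      if r = 0 then doubleStripKernel u (μ + Finsupp.single k 1) ρ
      else if r = 1 then doubleStripKernel u μ ρ else 0 := by
  have hadd := doubleStripKernel_add_two (A := A) u hμ hρ
  set X := (u : A) ^ (μ.degree + ρ.degree) *
    ∏ j ∈ range k, stepSum u (loEntry μ ρ j) (hiEntry μ ρ j)
  have hzero := hadd 0 0 0
  have hone := hadd 1 0
  simp only [Finsupp.single_zero, add_zero] at hzero hone
  rcases lt_trichotomy r 1 with hr1 | rfl | hr1
  · obtain rfl : r = 0 := by omega
    rw [if_pos rfl, hadd, stepSum_of_lt u (b := min 0 2) (by simp)]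
    simp
  · have hu : (u : A) ^ 2 * ((u⁻¹ : Aˣ) : A) ^ 2 = 1 := by rw [← mul_pow, Units.mul_inv, one_pow]
    rw [if_neg one_ne_zero, if_pos rfl, hone, hadd, hzero]
    simp only [max_self, zero_le, min_eq_left, min_self, Nat.one_le_ofNat, max_eq_left,
      stepSum_eq_add u (Nat.zero_le (hiEntry μ ρ k)), stepSum_eq_add u (hr rfl),
      stepSum_eq_add u zero_le_one, stepSum_self, zero_add, mul_zero, pow_zero, mul_one,
      Nat.reduceAdd]
    linear_combination X * (1 + ((u⁻¹ : Aˣ) : A) ^ 2 + stepSum u 2 (hiEntry μ ρ k) -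
      u ^ 2 * stepSum u 2 (hiEntry μ ρ k)) * hu
  · have := doubleStripKernel_add_succ (A := A) u hμ hρ 0 hr1
    simp only [Finsupp.single_zero, add_zero, zero_add, Nat.reduceAdd] at this
    rw [if_neg (by omega), if_neg hr1.ne', this, sub_self]

theorem doubleStripKernel_add_one_one_one (u : Aˣ) {k : ℕ} {μ ρ : ℕ →₀ ℕ}
    (hμ : LenLE k μ) (hρ : LenLE (k + 2) ρ) {r : ℕ} (hr : r ≤ ρ (k + 1)) :
    (doubleStripKernel u
        (μ + Finsupp.single k 1 + Finsupp.single (k + 1) 1 + Finsupp.single (k + 2) 1)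
        (ρ + Finsupp.single (k + 2) r) : A) =
      if r = 0 then doubleStripKernel u (μ + Finsupp.single (k + 1) 1) ρ
      else if r = 1 then doubleStripKernel u μ ρ else 0 := by
  obtain ⟨ρ, s, hρ', rfl⟩ : ∃ ρ' s, LenLE (k + 1) ρ' ∧ ρ = ρ' + Finsupp.single (k + 1) s :=
    ⟨_, _, hρ.erase, (Finsupp.erase_add_single _ _).symm⟩
  have hrs : r ≤ s := by simpa [hρ' (k + 1) le_rfl] using hr
  have hadd := doubleStripKernel_add_three (A := A) u hμ hρ'
  have hzero := hadd 0 0 0 s 0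
  have hone := hadd 0 1 0 s 0
  simp only [Finsupp.single_zero, add_zero] at hzero hone
  rcases lt_trichotomy r 1 with hr1 | rfl | hr1
  · obtain rfl : r = 0 := by omega
    rw [if_pos rfl, hadd, hone, stepSum_of_lt u (a := 1) (b := min 0 1) (by simp),
      stepSum_of_lt u (a := max 1 0) (b := min s 0) (by simp)]
    simp
  · rw [if_neg one_ne_zero, if_pos rfl, hadd, hzero, max_eq_right hrs, min_eq_right hrs,
      max_eq_right zero_le, min_eq_right zero_le, max_self, min_self, max_self, min_self,
      ← sq_mul_stepSum_succ u 0 0]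
    ring
  · rw [if_neg (by omega), if_neg hr1.ne', hadd,
      stepSum_of_lt u (a := max 1 r) (b := min s 1) (by omega)]
    simp

theorem sum_Iic_eq_sum_rowsUpTo {k R : ℕ} {ν : ℕ →₀ ℕ} (hν : LenLE (k + 1) ν) (hR : ν k < R)
    (F : (ℕ →₀ ℕ) → A) (hF : ∀ ρ, ¬ ρ ≤ ν → F ρ = 0) :
    ∑ ρ ∈ Iic ν, F ρ = ∑ ρ ∈ rowsUpTo k ν, ∑ r ∈ range R, F (ρ + Finsupp.single k r) := by
  rw [← sum_product']
  symm
  refine sum_bij_ne_zero (fun p _ _ => p.1 + Finsupp.single k p.2) ?_ ?_ ?_ fun _ _ _ => rfl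
  · exact fun p _ hp => mem_Iic.2 (by_contra fun h => hp (hF _ h))
  · rintro ⟨ρ, r⟩ hρ - ⟨ρ', r'⟩ hρ' - h
    simp only [mem_product, mem_rowsUpTo] at hρ hρ' h
    obtain rfl : r = r' := by
      simpa [hρ.1.2 k le_rfl, hρ'.1.2 k le_rfl] using DFunLike.congr_fun h k
    rw [add_right_cancel h]
  · intro ρ hρ h0
    have hρν := mem_Iic.1 hρ
    have herase : ρ.erase k ≤ ρ := by
      conv_rhs => rw [← Finsupp.erase_add_single k ρ]
      exact le_self_add
    refine ⟨(ρ.erase k, ρ k), mem_product.2 ⟨?_, mem_range.2 ((hρν k).trans_lt hR)⟩, ?_, ?_⟩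
    · exact mem_rowsUpTo.2 ⟨herase.trans hρν, (hν.mono hρν).erase⟩
    · rwa [Finsupp.erase_add_single]
    · exact Finsupp.erase_add_single k ρ

theorem doubleStripKernel_mul_apply_eq_sum_rowsUpTo (u v : Aˣ) {k : ℕ} (μ : ℕ →₀ ℕ)
    {ν : ℕ →₀ ℕ} (hν : LenLE (k + 1) ν) :
    (doubleStripKernel u * doubleStripKernel v : IncidenceAlgebra A (ℕ →₀ ℕ)) μ ν =
      ∑ ρ ∈ rowsUpTo k ν, ∑ r ∈ range (ν k + 2),
        doubleStripKernel u μ (ρ + Finsupp.single k r) *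
          doubleStripKernel v (ρ + Finsupp.single k r) ν := by
  rw [doubleStripKernel_mul_apply, sum_Iic_eq_sum_rowsUpTo hν (R := ν k + 2) (by omega)]
  intro ρ hρ
  rw [IncidenceAlgebra.apply_eq_zero_of_not_le hρ, mul_zero]

/- Truncating `ρ` to `k + 1` entries keeps this sum from being a value of the commutative
convolution product; the correction is what remains of a telescoping sum over the entry
`ρ_{k+1}`. -/
theorem sum_rowsUpTo_doubleStripKernel_mul (u v : Aˣ) {k : ℕ} {μ ν : ℕ →₀ ℕ} (hμ : LenLE k μ)
    (hν : LenLE (k + 2) ν) :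
    (∑ ρ ∈ rowsUpTo (k + 1) ν, doubleStripKernel u μ ρ * doubleStripKernel v ρ ν : A) =
      (doubleStripKernel u * doubleStripKernel v) μ ν -
        (doubleStripKernel u * doubleStripKernel v)
          (μ + Finsupp.single k 1 + Finsupp.single (k + 1) 1) ν := by
  simp_rw [doubleStripKernel_mul_apply_eq_sum_rowsUpTo u v _ hν, ← sum_sub_distrib, ← sub_mul]
  refine sum_congr rfl fun ρ hρ => ?_
  simp_rw [doubleStripKernel_sub_add_one_one u hμ (mem_rowsUpTo.1 hρ).2]
  simp

theorem sum_rowsUpTo_doubleStripKernel_add_one_mul (u v : Aˣ) {k : ℕ} {μ ν : ℕ →₀ ℕ}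
    (hμ : LenLE k μ) (hν : LenLE (k + 2) ν) :
    (∑ ρ ∈ rowsUpTo (k + 1) ν, doubleStripKernel u (μ + Finsupp.single k 1) ρ *
        doubleStripKernel v (ρ + Finsupp.single (k + 1) 1) ν : A) =
      (doubleStripKernel u * doubleStripKernel v)
          (μ + Finsupp.single k 1 + Finsupp.single (k + 1) 1) ν -
        (doubleStripKernel u * doubleStripKernel v)
          (μ + Finsupp.single k 2 + Finsupp.single (k + 1) 2) ν := by
  simp_rw [doubleStripKernel_mul_apply_eq_sum_rowsUpTo u v _ hν, ← sum_sub_distrib, ← sub_mul]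
  refine sum_congr rfl fun ρ hρ => ?_
  simp_rw [doubleStripKernel_add_one_one_sub_add_two_two u hμ (mem_rowsUpTo.1 hρ).2]
  simp

theorem sum_ite_zero_ite_one_mul {R : ℕ} (hR : 2 ≤ R) (a b : A) (F : ℕ → A) :
    ∑ r ∈ range R, (if r = 0 then a else if r = 1 then b else 0) * F r = a * F 0 + b * F 1 := by
  rw [← sum_subset (range_subset_range.2 hR), sum_range_succ, sum_range_one]
  · simp
  · intro r _ hr
    rw [mem_range, not_lt] at hr
    rw [if_neg (by omega), if_neg (by omega), zero_mul]

theorem sum_rowsUpTo_add_eq_sum_range (v : Aˣ) {k : ℕ} {ν : ℕ →₀ ℕ} {K a b : (ℕ →₀ ℕ) → A}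
    (hK : ∀ ρ, LenLE (k + 1) ρ → ∀ r ≤ ρ k, K (ρ + Finsupp.single (k + 1) r) =
      if r = 0 then a ρ else if r = 1 then b ρ else 0) :
    ∑ ρ ∈ rowsUpTo (k + 1) ν, (a ρ * doubleStripKernel v ρ ν +
        b ρ * doubleStripKernel v (ρ + Finsupp.single (k + 1) 1) ν) =
      ∑ ρ ∈ rowsUpTo (k + 1) ν, ∑ r ∈ range (ν (k + 1) + 2),
        K (ρ + Finsupp.single (k + 1) r) *
          doubleStripKernel v (ρ + Finsupp.single (k + 1) r) ν := by
  refine sum_congr rfl fun ρ hρ => ?_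
  have hlen := (mem_rowsUpTo.1 hρ).2
  have hsum := sum_ite_zero_ite_one_mul (Nat.le_add_left 2 (ν (k + 1))) (a ρ) (b ρ)
    fun r => doubleStripKernel v (ρ + Finsupp.single (k + 1) r) ν
  simp only [Finsupp.single_zero, add_zero] at hsum
  rw [← hsum]
  refine sum_congr rfl fun r _ => ?_
  by_cases h0 : doubleStripKernel v (ρ + Finsupp.single (k + 1) r) ν = 0
  · rw [h0, mul_zero, mul_zero]
  · rw [hK ρ hlen r]
    simpa [hlen (k + 1) le_rfl] using antitone_of_doubleStripKernel_ne_zero h0 k.le_succ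

theorem sum_rowsUpTo_mixed_of_pos (u v : Aˣ) {k : ℕ} {μ ν : ℕ →₀ ℕ} (hμ : LenLE k μ)
    (hpos : ∀ i, k = i + 1 → 1 ≤ μ i) (hν : LenLE (k + 2) ν) :
    (∑ ρ ∈ rowsUpTo (k + 1) ν,
        (doubleStripKernel u (μ + Finsupp.single k 1) ρ * doubleStripKernel v ρ ν +
          doubleStripKernel u μ ρ * doubleStripKernel v (ρ + Finsupp.single (k + 1) 1) ν) : A) =
      (doubleStripKernel u * doubleStripKernel v) (μ + Finsupp.single k 1) ν -
        (doubleStripKernel u * doubleStripKernel v)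
          (μ + Finsupp.single k 2 + Finsupp.single (k + 1) 1) ν := by
  simp_rw [doubleStripKernel_mul_apply_eq_sum_rowsUpTo u v _ hν, ← sum_sub_distrib, ← sub_mul]
  refine sum_rowsUpTo_add_eq_sum_range v (K := fun ρ =>
    doubleStripKernel u (μ + Finsupp.single k 1) ρ -
      doubleStripKernel u (μ + Finsupp.single k 2 + Finsupp.single (k + 1) 1) ρ)
    fun ρ hρ r hr => doubleStripKernel_add_one_sub_add_two_one u hμ hρ ?_
  rintro rfl
  cases k with
  | zero => exact hr
  | succ i => exact le_min hr (hpos i rfl)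

theorem sum_rowsUpTo_mixed_of_zero (u v : Aˣ) {k : ℕ} {μ ν : ℕ →₀ ℕ} (hμ : LenLE k μ)
    (hν : LenLE (k + 3) ν) :
    (∑ ρ ∈ rowsUpTo (k + 2) ν,
        (doubleStripKernel u (μ + Finsupp.single (k + 1) 1) ρ * doubleStripKernel v ρ ν +
          doubleStripKernel u μ ρ * doubleStripKernel v (ρ + Finsupp.single (k + 2) 1) ν) : A) =
      (doubleStripKernel u * doubleStripKernel v)
        (μ + Finsupp.single k 1 + Finsupp.single (k + 1) 1 + Finsupp.single (k + 2) 1) ν := by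
  rw [doubleStripKernel_mul_apply_eq_sum_rowsUpTo u v _ hν]
  exact sum_rowsUpTo_add_eq_sum_range v fun ρ hρ r hr =>
    doubleStripKernel_add_one_one_one u hμ hρ hr

theorem sum_rowsUpTo_mixed_comm (u v : Aˣ) {k : ℕ} {μ ν : ℕ →₀ ℕ} (hμ : LenLE k μ)
    (hν : LenLE (k + 2) ν) :
    (∑ ρ ∈ rowsUpTo (k + 1) ν,
        (doubleStripKernel u (μ + Finsupp.single k 1) ρ * doubleStripKernel v ρ ν +
          doubleStripKernel u μ ρ * doubleStripKernel v (ρ + Finsupp.single (k + 1) 1) ν) : A) =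
      ∑ ρ ∈ rowsUpTo (k + 1) ν,
        (doubleStripKernel v (μ + Finsupp.single k 1) ρ * doubleStripKernel u ρ ν +
          doubleStripKernel v μ ρ * doubleStripKernel u (ρ + Finsupp.single (k + 1) 1) ν) := by
  by_cases hpos : ∀ i, k = i + 1 → 1 ≤ μ i
  · rw [sum_rowsUpTo_mixed_of_pos u v hμ hpos hν, sum_rowsUpTo_mixed_of_pos v u hμ hpos hν,
      (doubleStripKernel_commute u v).eq]
  · push Not at hpos
    obtain ⟨i, rfl, hi⟩ := hpos
    have hμ' : LenLE i μ := fun j hj => by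
      rcases hj.eq_or_lt with rfl | hj
      · omega
      · exact hμ j hj
    rw [sum_rowsUpTo_mixed_of_zero u v hμ' hν, sum_rowsUpTo_mixed_of_zero v u hμ' hν,
      (doubleStripKernel_commute u v).eq]

/-- The kernel `doubleStripKernel u` on rows `μ` with `k` entries, deformed by `β`: by
`rowKernel_eq_cbKernel`, every non-zero last part of the row between `μ` and `ν` gets the weight
`1 + β u`. -/
def cbKernel (β : A) (k : ℕ) (u : Aˣ) (μ ν : ℕ →₀ ℕ) : A :=
  doubleStripKernel u μ ν + β * doubleStripKernel u (μ + Finsupp.single k 1) ν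

theorem sum_rowsUpTo_cbKernel_comm (β : A) (u v : Aˣ) {k : ℕ} {μ ν : ℕ →₀ ℕ} (hμ : LenLE k μ)
    (hν : LenLE (k + 2) ν) :
    ∑ ρ ∈ rowsUpTo (k + 1) ν, cbKernel β k u μ ρ * cbKernel β (k + 1) v ρ ν =
      ∑ ρ ∈ rowsUpTo (k + 1) ν, cbKernel β k v μ ρ * cbKernel β (k + 1) u ρ ν := by
  have expand : ∀ u v : Aˣ,
      ∑ ρ ∈ rowsUpTo (k + 1) ν, cbKernel β k u μ ρ * cbKernel β (k + 1) v ρ ν =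
        ∑ ρ ∈ rowsUpTo (k + 1) ν, doubleStripKernel u μ ρ * doubleStripKernel v ρ ν +
        β * ∑ ρ ∈ rowsUpTo (k + 1) ν,
          (doubleStripKernel u (μ + Finsupp.single k 1) ρ * doubleStripKernel v ρ ν +
            doubleStripKernel u μ ρ * doubleStripKernel v (ρ + Finsupp.single (k + 1) 1) ν) +
        β ^ 2 * ∑ ρ ∈ rowsUpTo (k + 1) ν, doubleStripKernel u (μ + Finsupp.single k 1) ρ *
          doubleStripKernel v (ρ + Finsupp.single (k + 1) 1) ν := fun u v => by
    simp_rw [mul_sum, ← sum_add_distrib, cbKernel]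
    exact sum_congr rfl fun ρ _ => by ring
  simp only [expand, sum_rowsUpTo_mixed_comm u v hμ hν,
    sum_rowsUpTo_doubleStripKernel_mul _ _ hμ hν,
    sum_rowsUpTo_doubleStripKernel_add_one_mul _ _ hμ hν, (doubleStripKernel_commute u v).eq]

end

/-! ### Generating functions of chains of rows -/

section

variable {A : Type*} [CommRing A]

theorem hStrip_add_single_iff {k : ℕ} {μ κ : ℕ →₀ ℕ} (hμ : LenLE k μ) (hκ : LenLE (k + 1) κ) :
    HStrip (μ + Finsupp.single k 1) κ ↔ HStrip μ κ ∧ κ k ≠ 0 := by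
  have at_k : (μ + Finsupp.single k 1 : ℕ →₀ ℕ) k = 1 := by simp [hμ k le_rfl]
  have off_k : ∀ j, j ≠ k → (μ + Finsupp.single k 1 : ℕ →₀ ℕ) j = μ j := fun j hj => by
    simp [hj.symm]
  constructor
  · refine fun h => ⟨fun j => ?_, by have := (h k).2; omega⟩
    rcases eq_or_ne j k with rfl | hj
    · simp [hκ (j + 1) le_rfl, hμ j le_rfl]
    · simpa only [off_k j hj] using h j
  · rintro ⟨h, hk⟩ j
    rcases eq_or_ne j k with rfl | hj
    · have := hκ (j + 1) le_rfl
      omega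
    · simpa only [off_k j hj] using h j

/-- The transfer kernel of two successive rows of a pattern, from a row `μ` with `k` entries to a
row `ν` with `k + 1` entries: the last part `κ_k` of the row `κ` between them has weight
`g κ_k`. -/
def rowKernel (k : ℕ) (u : Aˣ) (g : ℕ → A) (μ ν : ℕ →₀ ℕ) : A :=
  ∑ κ ∈ rowsAbove (k + 1) ν, if HStrip μ κ then
    ((u ^ ((ν.degree : ℤ) - 2 * κ.degree + μ.degree) : Aˣ) : A) * g (κ k) else 0

theorem sum_rowsUpTo_mul_rowKernel (F : (ℕ →₀ ℕ) → A) (k : ℕ) (u : Aˣ) (g : ℕ → A)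
    {ν ν' : ℕ →₀ ℕ} (hν : ν ≤ ν') :
    ∑ μ ∈ rowsUpTo k ν', F μ * rowKernel k u g μ ν =
      ∑ κ ∈ rowsAbove (k + 1) ν, ∑ μ ∈ rowsAbove k κ,
        ((u ^ ((ν.degree : ℤ) - 2 * κ.degree + μ.degree) : Aˣ) : A) * g (κ k) * F μ := by
  simp_rw [rowKernel, mul_sum, mul_ite, mul_zero]
  rw [sum_comm]
  refine sum_congr rfl fun κ hκ => ?_
  have hκν := (mem_rowsAbove.1 hκ).2.le.trans hν
  rw [← sum_filter]
  refine sum_congr ?_ fun μ _ => mul_comm _ _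
  ext μ
  rw [mem_filter, mem_rowsUpTo, mem_rowsAbove]
  exact ⟨fun h => ⟨h.1.2, h.2⟩, fun h => ⟨⟨h.2.le.trans hκν, h.1⟩, h.2⟩⟩

theorem rowKernel_eq_cbKernel (β : A) (k : ℕ) (u : Aˣ) {μ ν : ℕ →₀ ℕ} (hμ : LenLE k μ)
    (hν : LenLE (k + 1) ν) :
    rowKernel k u (fun c => if c = 0 then 1 else 1 + β * u) μ ν = cbKernel β k u μ ν := by
  rw [cbKernel, doubleStripKernel_apply u μ hν, doubleStripKernel_apply u _ hν, mul_sum,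
    ← sum_add_distrib]
  refine sum_congr rfl fun κ hκ => ?_
  simp only [hStrip_add_single_iff hμ (mem_rowsAbove.1 hκ).1]
  by_cases hμκ : HStrip μ κ
  · by_cases h0 : κ k = 0
    · simp [hμκ, h0]
    · simp only [hμκ, h0, ne_eq, not_false_eq_true, and_self, if_true, if_false, map_add,
        Finsupp.degree_single, Nat.cast_add, Nat.cast_one, ← add_assoc, zpow_add_one,
        Units.val_mul]
      ring
  · simp [hμκ]

theorem rowKernel_const (k : ℕ) (u : Aˣ) (c : A) {μ ν : ℕ →₀ ℕ} (hν : LenLE (k + 1) ν) :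
    rowKernel k u (fun _ => c) μ ν = cbKernel 0 k u μ ν * c := by
  rw [cbKernel, zero_mul, add_zero, doubleStripKernel_apply u μ hν, rowKernel, sum_mul]
  simp only [ite_mul, zero_mul]

variable {σ : Type*}

/-- The row kernels of the variables `U v`, with weights `g v`, commute with each other. -/
def RowKernelsCommute (U : σ → Aˣ) (g : σ → ℕ → A) : Prop :=
  ∀ (v w : σ) (k : ℕ) (μ ν : ℕ →₀ ℕ), LenLE k μ → LenLE (k + 2) ν →
    ∑ ρ ∈ rowsUpTo (k + 1) ν,
      rowKernel k (U v) (g v) μ ρ * rowKernel (k + 1) (U w) (g w) ρ ν =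
    ∑ ρ ∈ rowsUpTo (k + 1) ν,
      rowKernel k (U w) (g w) μ ρ * rowKernel (k + 1) (U v) (g v) ρ ν

theorem rowKernelsCommute_cb (U : σ → Aˣ) (β : A) :
    RowKernelsCommute U fun v c => if c = 0 then 1 else 1 + β * U v := by
  intro v w k μ ν hμ hν
  have eq_cbKernel : ∀ v w, ∑ ρ ∈ rowsUpTo (k + 1) ν,
      rowKernel k (U v) (fun c => if c = 0 then 1 else 1 + β * U v) μ ρ *
        rowKernel (k + 1) (U w) (fun c => if c = 0 then 1 else 1 + β * U w) ρ ν =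
      ∑ ρ ∈ rowsUpTo (k + 1) ν, cbKernel β k (U v) μ ρ * cbKernel β (k + 1) (U w) ρ ν :=
    fun v w => sum_congr rfl fun ρ hρ => by
      have hρ := (mem_rowsUpTo.1 hρ).2
      rw [rowKernel_eq_cbKernel β k (U v) hμ hρ, rowKernel_eq_cbKernel β (k + 1) (U w) hρ hν]
  rw [eq_cbKernel, eq_cbKernel, sum_rowsUpTo_cbKernel_comm β _ _ hμ hν]

theorem rowKernelsCommute_const (U : σ → Aˣ) (c : σ → A) :
    RowKernelsCommute U fun v _ => c v := by
  intro v w k μ ν hμ hν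
  have eq_cbKernel : ∀ v w, ∑ ρ ∈ rowsUpTo (k + 1) ν,
      rowKernel k (U v) (fun _ => c v) μ ρ * rowKernel (k + 1) (U w) (fun _ => c w) ρ ν =
      (∑ ρ ∈ rowsUpTo (k + 1) ν, cbKernel 0 k (U v) μ ρ * cbKernel 0 (k + 1) (U w) ρ ν) *
        (c v * c w) := fun v w => by
    rw [sum_mul]
    refine sum_congr rfl fun ρ hρ => ?_
    rw [rowKernel_const k (U v) (c v) (mem_rowsUpTo.1 hρ).2,
      rowKernel_const (k + 1) (U w) (c w) hν]
    ring
  rw [eq_cbKernel, eq_cbKernel, sum_rowsUpTo_cbKernel_comm 0 _ _ hμ hν, mul_comm (c v)]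

/-- The generating function of the patterns with an even number of rows whose last row is the
argument; the head of the list is the variable of the last two rows. -/
def patternSum (U : σ → Aˣ) (g : σ → ℕ → A) : List σ → (ℕ →₀ ℕ) → A
  | [], _ => 1
  | v :: l, ν => ∑ κ ∈ rowsAbove (l.length + 1) ν, ∑ μ ∈ rowsAbove l.length κ,
      ((U v ^ ((ν.degree : ℤ) - 2 * κ.degree + μ.degree) : Aˣ) : A) * g v (κ l.length) *
        patternSum U g l μ

theorem patternSum_cons (U : σ → Aˣ) (g : σ → ℕ → A) (v : σ) (l : List σ) (ν : ℕ →₀ ℕ) :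
    patternSum U g (v :: l) ν =
      ∑ κ ∈ rowsAbove (l.length + 1) ν, ∑ μ ∈ rowsAbove l.length κ,
        ((U v ^ ((ν.degree : ℤ) - 2 * κ.degree + μ.degree) : Aˣ) : A) * g v (κ l.length) *
          patternSum U g l μ := rfl

theorem patternSum_cons_eq_sum_rowKernel (U : σ → Aˣ) (g : σ → ℕ → A) (v : σ) (l : List σ)
    {ν ν' : ℕ →₀ ℕ} (hν : ν ≤ ν') :
    patternSum U g (v :: l) ν = ∑ μ ∈ rowsUpTo l.length ν',
      patternSum U g l μ * rowKernel l.length (U v) (g v) μ ν := by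
  rw [sum_rowsUpTo_mul_rowKernel _ _ _ _ hν, patternSum_cons]

theorem patternSum_cons_cons (U : σ → Aˣ) (g : σ → ℕ → A) (v w : σ) (l : List σ) (ν : ℕ →₀ ℕ) :
    patternSum U g (v :: w :: l) ν = ∑ μ ∈ rowsUpTo l.length ν,
      patternSum U g l μ * ∑ ρ ∈ rowsUpTo (l.length + 1) ν,
        rowKernel l.length (U w) (g w) μ ρ * rowKernel (l.length + 1) (U v) (g v) ρ ν := by
  simp_rw [patternSum_cons_eq_sum_rowKernel U g v (w :: l) le_rfl, mul_sum, ← mul_assoc]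
  rw [sum_comm]
  refine sum_congr rfl fun ρ hρ => ?_
  rw [patternSum_cons_eq_sum_rowKernel U g w l (mem_rowsUpTo.1 hρ).1, sum_mul, List.length_cons]

theorem patternSum_perm {U : σ → Aˣ} {g : σ → ℕ → A} (hc : RowKernelsCommute U g)
    {l l' : List σ} (h : l.Perm l') {ν : ℕ →₀ ℕ} (hν : LenLE l.length ν) :
    patternSum U g l ν = patternSum U g l' ν := by
  induction h generalizing ν with
  | nil => rfl
  | cons v h ih =>
    rw [patternSum_cons, patternSum_cons, h.length_eq]
    refine sum_congr rfl fun κ _ => sum_congr rfl fun μ hμ => ?_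
    rw [ih (h.length_eq ▸ (mem_rowsAbove.1 hμ).1)]
  | swap v w l =>
    rw [patternSum_cons_cons, patternSum_cons_cons]
    exact sum_congr rfl fun μ hμ => by rw [hc v w l.length μ ν (mem_rowsUpTo.1 hμ).2 hν]
  | trans h₁ _ ih₁ ih₂ => rw [ih₁ hν, ih₂ (h₁.length_eq ▸ hν)]

end

/-! ### Rows beginning with a constant block -/

/-- The row `(u^{(q)}, λ)`. -/
def preRow (q u : ℕ) (lam : ℕ →₀ ℕ) : ℕ →₀ ℕ :=
  Finsupp.onFinset (range q ∪ lam.support.image (· + q))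
    (fun i => if i < q then u else lam (i - q)) fun i hi => by
      simp only [mem_union, mem_range, mem_image, Finsupp.mem_support_iff]
      by_cases h : i < q
      · exact Or.inl h
      · exact Or.inr ⟨i - q, by rwa [if_neg h] at hi, by omega⟩

theorem preRow_apply (q u : ℕ) (lam : ℕ →₀ ℕ) (i : ℕ) :
    preRow q u lam i = if i < q then u else lam (i - q) := rfl

theorem preRow_apply_of_lt {q i : ℕ} (h : i < q) (u : ℕ) (lam : ℕ →₀ ℕ) :
    preRow q u lam i = u := if_pos h

@[simp]
theorem preRow_apply_add (q u : ℕ) (lam : ℕ →₀ ℕ) (i : ℕ) : preRow q u lam (q + i) = lam i := by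
  rw [preRow_apply, if_neg (by omega), Nat.add_sub_cancel_left]

theorem preRow_injective (q u : ℕ) : Function.Injective (preRow q u) := fun lam lam' h =>
  Finsupp.ext fun i => by simpa using DFunLike.congr_fun h (q + i)

theorem exists_preRow_eq {q u : ℕ} {κ : ℕ →₀ ℕ} (h : ∀ i < q, κ i = u) :
    ∃ κ', preRow q u κ' = κ :=
  ⟨κ.comapDomain (q + ·) (add_right_injective q).injOn, Finsupp.ext fun i => by
    rcases lt_or_ge i q with hi | hi
    · rw [preRow_apply_of_lt hi, h i hi]
    · obtain ⟨j, rfl⟩ := Nat.exists_eq_add_of_le hi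
      simp⟩

@[simp]
theorem preRow_zero (u : ℕ) (lam : ℕ →₀ ℕ) : preRow 0 u lam = lam :=
  Finsupp.ext fun i => by simp [preRow_apply]

theorem lenLE_preRow_iff {p q u : ℕ} {lam : ℕ →₀ ℕ} :
    LenLE (q + p) (preRow q u lam) ↔ LenLE p lam := by
  refine ⟨fun h j hj => by simpa using h (q + j) (by omega), fun h j hj => ?_⟩
  obtain ⟨i, rfl⟩ := Nat.exists_eq_add_of_le ((Nat.le_add_right q p).trans hj)
  rw [preRow_apply_add, h i (by omega)]

theorem preRow_le_iff {q u : ℕ} {lam : ℕ →₀ ℕ} : (∀ i, preRow q u lam i ≤ u) ↔ ∀ i, lam i ≤ u := by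
  refine ⟨fun h i => by simpa using h (q + i), fun h i => ?_⟩
  rw [preRow_apply]
  split_ifs
  exacts [le_rfl, h _]

theorem degree_preRow (q u : ℕ) (lam : ℕ →₀ ℕ) :
    (preRow q u lam).degree = q * u + lam.degree := by
  obtain ⟨p, hp⟩ := exists_lenLE lam
  rw [(lenLE_preRow_iff.2 hp).degree_eq, sum_range_add, hp.degree_eq,
    sum_congr rfl fun i hi => preRow_apply_of_lt (mem_range.1 hi) u lam]
  simp

/-- The rows with at most `p` non-zero entries, all of them at most `u`. -/
def rowBox (p u : ℕ) : Finset (ℕ →₀ ℕ) := Iic (preRow p u 0)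

theorem mem_rowBox {p u : ℕ} {lam : ℕ →₀ ℕ} :
    lam ∈ rowBox p u ↔ LenLE p lam ∧ ∀ i, lam i ≤ u := by
  rw [rowBox, mem_Iic]
  refine ⟨fun h => ⟨LenLE.mono ((lenLE_preRow_iff (p := 0)).2 fun _ _ => rfl) h,
    fun i => (h i).trans (preRow_le_iff.2 (fun _ => zero_le) i)⟩, fun ⟨hlen, hle⟩ i => ?_⟩
  rcases lt_or_ge i p with hi | hi
  · exact (hle i).trans_eq (preRow_apply_of_lt hi u 0).symm
  · exact (hlen i hi).trans_le zero_le

theorem rowBox_zero (u : ℕ) : rowBox 0 u = {0} := by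
  rw [rowBox, preRow_zero]
  exact Iic_bot

theorem hStrip_preRow_iff {q u : ℕ} {κ lam : ℕ →₀ ℕ} (hκ : κ 0 ≤ u) :
    HStrip (preRow q u κ) (preRow (q + 1) u lam) ↔ HStrip lam κ := by
  have shift : ∀ j, preRow (q + 1) u lam (q + (j + 1)) = lam j := fun j => by
    rw [← preRow_apply_add (q + 1) u lam j, add_right_comm, add_assoc]
  constructor
  · intro h j
    have above := (h (q + j)).1
    have below := (h (q + (j + 1))).2
    rw [add_assoc, shift, preRow_apply_add] at above
    rw [shift, preRow_apply_add] at below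
    exact ⟨below, above⟩
  · intro h j
    rcases lt_or_ge j q with hj | hj
    · rw [preRow_apply_of_lt hj, preRow_apply_of_lt (by omega), preRow_apply_of_lt (by omega)]
      exact ⟨le_rfl, le_rfl⟩
    obtain ⟨i, rfl⟩ := Nat.exists_eq_add_of_le hj
    rw [add_assoc, shift, preRow_apply_add]
    cases i with
    | zero => exact ⟨(h 0).2, hκ.trans_eq (preRow_apply_of_lt (by omega) u lam).symm⟩
    | succ i => exact ⟨(h (i + 1)).2, (shift i).symm ▸ (h i).1⟩

theorem rowsAbove_preRow {p q u : ℕ} {lam : ℕ →₀ ℕ} (hlam : ∀ i, lam i ≤ u) :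
    rowsAbove (q + p) (preRow (q + 1) u lam) =
      ((rowBox p u).filter (HStrip lam)).image (preRow q u) := by
  ext κ
  simp only [mem_rowsAbove, mem_image, mem_filter, mem_rowBox]
  constructor
  · rintro ⟨hlen, hstrip⟩
    have hle : ∀ i, κ i ≤ u := fun i => (hstrip.le i).trans (preRow_le_iff.2 hlam i)
    obtain ⟨κ', rfl⟩ := exists_preRow_eq (κ := κ) (q := q) fun i hi =>
      (hle i).antisymm ((preRow_apply_of_lt (by omega) u lam).symm.trans_le (hstrip i).1)
    have hle' := preRow_le_iff.1 hle
    exact ⟨κ', ⟨⟨lenLE_preRow_iff.1 hlen, hle'⟩, (hStrip_preRow_iff (hle' 0)).1 hstrip⟩, rfl⟩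
  · rintro ⟨κ', ⟨⟨hlen, hle⟩, hstrip⟩, rfl⟩
    exact ⟨lenLE_preRow_iff.2 hlen, (hStrip_preRow_iff (hle 0)).2 hstrip⟩

/- The row `(u^{(q)}, κ)` lies above `(u^{(q + 1)}, λ)` exactly when `λ` lies above `κ`: stripping
the constant blocks turns the pattern upside down. -/
theorem sum_rowBox_rowsAbove_preRow {M : Type*} [AddCommMonoid M] (p p' q u : ℕ)
    (Φ : (ℕ →₀ ℕ) → (ℕ →₀ ℕ) → M) :
    ∑ lam ∈ rowBox p u, ∑ κ ∈ rowsAbove (q + p') (preRow (q + 1) u lam), Φ lam κ =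
      ∑ κ ∈ rowBox p' u, ∑ lam ∈ rowsAbove p κ, Φ lam (preRow q u κ) := by
  rw [sum_congr rfl fun lam hlam => by
    rw [rowsAbove_preRow (mem_rowBox.1 hlam).2, sum_image (preRow_injective q u).injOn]]
  refine sum_comm' fun lam κ => ?_
  simp only [mem_filter, mem_rowBox, mem_rowsAbove]
  exact ⟨fun h => ⟨⟨h.1.1, h.2.2⟩, h.2.1⟩,
    fun h => ⟨⟨h.1.1, fun i => (h.1.2.le i).trans (h.2.2 i)⟩, h.2, h.1.2⟩⟩

/-! ### Rectangular shapes -/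

section

variable {A : Type*} [CommRing A] {σ : Type*}

theorem sum_patternSum_cons_mul (U : σ → Aˣ) (g : σ → ℕ → A) (u q : ℕ) (v : σ) (l r : List σ)
    (hl : l.length = q + (r.length + 1)) :
    ∑ lam ∈ rowBox r.length u,
      patternSum U g (v :: l) (preRow (q + 2) u lam) * patternSum U g r lam =
    ∑ lam ∈ rowBox (r.length + 1) u,
      patternSum U g l (preRow q u lam) * patternSum U g (v :: r) lam := by
  simp_rw [patternSum_cons, sum_mul, mul_sum, show l.length + 1 = q + 1 + (r.length + 1) by omega]
  rw [sum_rowBox_rowsAbove_preRow _ _ (q + 1)]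
  simp_rw [sum_comm (t := rowsAbove l.length _), hl]
  rw [sum_rowBox_rowsAbove_preRow _ _ q]
  refine sum_congr rfl fun μ _ => sum_congr rfl fun κ _ => sum_congr rfl fun lam _ => ?_
  rw [show q + (r.length + 1) = q + 1 + r.length by omega, preRow_apply_add]
  simp only [degree_preRow]
  rw [show (((q + 2) * u + lam.degree : ℕ) : ℤ) - 2 * ((q + 1) * u + κ.degree : ℕ) +
    (q * u + μ.degree : ℕ) = (μ.degree : ℤ) - 2 * κ.degree + lam.degree by push_cast; ring]
  ring

theorem sum_patternSum_append_mul (U : σ → Aˣ) (g : σ → ℕ → A) (u q : ℕ) (b l r : List σ)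
    (hl : l.length = q + r.length + b.length) :
    ∑ lam ∈ rowBox r.length u,
      patternSum U g (b ++ l) (preRow (q + 2 * b.length) u lam) * patternSum U g r lam =
    ∑ lam ∈ rowBox (r.length + b.length) u,
      patternSum U g l (preRow q u lam) * patternSum U g (b.reverse ++ r) lam := by
  induction b generalizing r with
  | nil => simp
  | cons v b ih =>
    rw [List.length_cons] at hl
    have peel := sum_patternSum_cons_mul U g u (q + 2 * b.length) v (b ++ l) r
      (by rw [List.length_append]; omega)
    have rest := ih (v :: r) (by rw [List.length_cons]; omega)
    simp only [List.length_cons, List.cons_append, List.reverse_cons, List.append_assoc,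
      List.nil_append] at rest ⊢
    rw [show q + 2 * (b.length + 1) = q + 2 * b.length + 2 by ring, peel, rest,
      show r.length + 1 + b.length = r.length + (b.length + 1) by ring]

theorem patternSum_append_rect {U : σ → Aˣ} {g : σ → ℕ → A} (hc : RowKernelsCommute U g)
    (u q : ℕ) (b l : List σ) (hl : l.length = q + b.length) :
    patternSum U g (b ++ l) (preRow (b.length + l.length) u 0) =
      ∑ lam ∈ rowBox b.length u, patternSum U g l (preRow q u lam) * patternSum U g b lam := by
  have key := sum_patternSum_append_mul U g u q b l [] (by simpa using hl)
  simp only [List.length_nil, rowBox_zero, sum_singleton, zero_add, List.append_nil,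
    patternSum, mul_one] at key
  rw [show b.length + l.length = q + 2 * b.length by omega, key]
  refine sum_congr rfl fun lam hlam => ?_
  rw [patternSum_perm hc (List.reverse_perm b)
    (b.length_reverse.symm ▸ (mem_rowBox.1 hlam).1)]

/-- The generating function of the patterns with an odd number of rows whose last row is the
argument; `s` is the variable of the last row. -/
def oddPatternSum (U : σ → Aˣ) (l : List σ) (s : σ) (κ : ℕ →₀ ℕ) : A :=
  ∑ μ ∈ rowsAbove l.length κ,
    ((U s ^ ((κ.degree : ℤ) - μ.degree) : Aˣ) : A) * patternSum U (fun _ _ => 1) l μ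

theorem rowKernel_const_inv (k : ℕ) (u : Aˣ) (c : A) {μ ν : ℕ →₀ ℕ} (hν : LenLE (k + 1) ν) :
    rowKernel k u⁻¹ (fun _ => c) μ ν = rowKernel k u (fun _ => c) μ ν := by
  simp only [rowKernel_const k _ c hν, cbKernel, doubleStripKernel_inv]

theorem patternSum_cons_eq_sum_oddPatternSum (U : σ → Aˣ) (s : σ) (l : List σ) {ν : ℕ →₀ ℕ}
    (hν : LenLE (l.length + 1) ν) :
    patternSum U (fun _ _ => 1) (s :: l) ν = ∑ κ ∈ rowsAbove (l.length + 1) ν,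
      ((U s ^ ((κ.degree : ℤ) - ν.degree) : Aˣ) : A) * oddPatternSum U l s κ := by
  rw [patternSum_cons_eq_sum_rowKernel U _ s l le_rfl]
  simp_rw [← rowKernel_const_inv _ (U s) 1 hν]
  rw [sum_rowsUpTo_mul_rowKernel _ _ _ _ le_rfl]
  refine sum_congr rfl fun κ _ => ?_
  rw [oddPatternSum, mul_sum]
  refine sum_congr rfl fun μ _ => ?_
  rw [mul_one, ← mul_assoc, ← Units.val_mul, ← zpow_add, inv_zpow']
  ring_nf

theorem patternSum_append_cons_rect (U : σ → Aˣ) (u q : ℕ) (b l : List σ) (s : σ)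
    (hl : l.length = q + b.length) :
    patternSum U (fun _ _ => 1) (b ++ s :: l) (preRow (b.length + l.length + 1) u 0) =
      ((U s ^ (-u : ℤ) : Aˣ) : A) * ∑ κ ∈ rowBox (b.length + 1) u,
        oddPatternSum U l s (preRow q u κ) * oddPatternSum U b s κ := by
  have split := patternSum_append_rect (rowKernelsCommute_const U fun _ => 1) u (q + 1) b (s :: l)
    (by rw [List.length_cons]; omega)
  rw [List.length_cons, ← add_assoc] at split
  rw [split, sum_congr rfl fun lam hlam => by
    rw [patternSum_cons_eq_sum_oddPatternSum U s l (by
      rw [show l.length + 1 = q + 1 + b.length by omega]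
      exact lenLE_preRow_iff.2 (mem_rowBox.1 hlam).1), sum_mul]]
  rw [show l.length + 1 = q + (b.length + 1) by omega, sum_rowBox_rowsAbove_preRow, mul_sum]
  refine sum_congr rfl fun κ _ => ?_
  rw [oddPatternSum.eq_def U b, mul_sum, mul_sum]
  refine sum_congr rfl fun lam _ => ?_
  rw [degree_preRow, degree_preRow,
    show ((q * u + κ.degree : ℕ) : ℤ) - ((q + 1) * u + lam.degree : ℕ) =
      -u + ((κ.degree : ℤ) - lam.degree) by push_cast; ring, zpow_add, Units.val_mul]
  ring

end

/-! ### Adding rows to arrays -/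

/-- The array `z` with its `N`-th row replaced by `r`. -/
def addRow (N : ℕ) (r : ℕ → ℚ) (z : ℕ → ℕ → ℚ) : ℕ → ℕ → ℚ :=
  fun i j => if i = N then r j else z i j

/-- Interlacing arrays of height `N` with bottom row `r`, whose entry in position `(i, j)`
satisfies `C i j`. This covers symplectic patterns as well as split orthogonal ones. -/
def patternsWith (N : ℕ) (C : ℕ → ℕ → ℚ → Prop) (r : ℕ → ℚ) : Set (ℕ → ℕ → ℚ) :=
  {z | IsArray N z ∧ (∀ i j, Idx N i j → C i j (z i j)) ∧ Interlacing N z ∧ z N = r}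

/-- `r` is a possible `N`-th row of an array with entries satisfying `C`, regardless of
interlacing. -/
def IsRow (N : ℕ) (C : ℕ → ℕ → ℚ → Prop) (r : ℕ → ℚ) : Prop :=
  (∀ j, Idx N N j → C N j (r j)) ∧ ∀ j, ¬ Idx N N j → r j = 0

/-- The `N`-th row `r'` and the `(N + 1)`-st row `r` satisfy the interlacing conditions. -/
def Interlaced (N : ℕ) (r' r : ℕ → ℚ) : Prop :=
  ∀ j, Idx N N j → r' j ≤ r j ∧ (Idx (N + 1) (N + 1) (j + 1) → r (j + 1) ≤ r' j)

theorem isRow_of_mem_patternsWith {N : ℕ} {C : ℕ → ℕ → ℚ → Prop} {r : ℕ → ℚ}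
    {z : ℕ → ℕ → ℚ} (hz : z ∈ patternsWith N C r) : IsRow N C r := by
  obtain ⟨hz0, hzC, -, rfl⟩ := hz
  exact ⟨hzC N, hz0 N⟩

theorem addRow_mem_patternsWith {N : ℕ} {C : ℕ → ℕ → ℚ → Prop} {r r' : ℕ → ℚ}
    {z : ℕ → ℕ → ℚ} (hr : IsRow (N + 1) C r) (hr' : Interlaced N r' r)
    (hz : z ∈ patternsWith N C r') : addRow (N + 1) r z ∈ patternsWith (N + 1) C r := by
  obtain ⟨hz0, hzC, ⟨hzle, hzge⟩, rfl⟩ := hz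
  refine ⟨fun i j => ?_, fun i j => ?_, ⟨fun i j => ?_, fun i j => ?_⟩, ?_⟩
  · grind [addRow, Idx, IsRow, IsArray]
  · grind [addRow, Idx, IsRow]
  · grind [addRow, Idx, Interlaced]
  · grind [addRow, Idx, Interlaced]
  · exact funext fun j => if_pos rfl

theorem exists_addRow_eq {N : ℕ} {C : ℕ → ℕ → ℚ → Prop} {r : ℕ → ℚ} {z : ℕ → ℕ → ℚ}
    (hz : z ∈ patternsWith (N + 1) C r) :
    ∃ r', Interlaced N r' r ∧ ∃ z' ∈ patternsWith N C r', addRow (N + 1) r z' = z := by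
  obtain ⟨hz0, hzC, ⟨hzle, hzge⟩, rfl⟩ := hz
  refine ⟨z N, fun j => ?_, addRow (N + 1) (fun _ => 0) z,
    ⟨fun i j => ?_, fun i j => ?_, ⟨fun i j => ?_, fun i j => ?_⟩, ?_⟩, ?_⟩
  · grind [Idx]
  · grind [addRow, Idx, IsArray]
  · grind [addRow, Idx]
  · grind [addRow, Idx]
  · grind [addRow, Idx]
  · exact funext fun j => if_neg (by omega)
  · grind [addRow]

theorem addRow_injOn (N : ℕ) (r : ℕ → ℚ) : Set.InjOn (addRow (N + 1) r) {z | IsArray N z} := by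
  intro z hz z' hz' h
  ext i j
  rcases eq_or_ne i (N + 1) with rfl | hi
  · have hij : ¬ Idx N (N + 1) j := fun h => absurd h.2.1 (by omega)
    rw [hz _ _ hij, hz' _ _ hij]
  · simpa [addRow, hi] using congrFun₂ h i j

theorem patternsWith_finite {C : ℕ → ℕ → ℚ → Prop} (hC : ∀ i j q, C i j q → IsHalfNat q) (N : ℕ)
    (r : ℕ → ℚ) : (patternsWith N C r).Finite :=
  finite_patterns N rfl (fun j => r (j + 1)) _ fun _ hz =>
    ⟨hz.1, fun i j hij => hC i j _ (hz.2.1 i j hij), hz.2.2.1, fun _ => congrFun hz.2.2.2 _⟩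

theorem finsum_patternsWith_succ {α A : Type*} [AddCommMonoid A] {N : ℕ}
    {C : ℕ → ℕ → ℚ → Prop} (hC : ∀ i j q, C i j q → IsHalfNat q) {r : ℕ → ℚ}
    (hr : IsRow (N + 1) C r) (S : Finset α) (row : α → ℕ → ℚ) (hinj : Set.InjOn row S)
    (hS : ∀ r', (∃ a ∈ S, row a = r') ↔ IsRow N C r' ∧ Interlaced N r' r)
    (f : (ℕ → ℕ → ℚ) → A) :
    ∑ᶠ z ∈ patternsWith (N + 1) C r, f z =
      ∑ a ∈ S, ∑ᶠ z ∈ patternsWith N C (row a), f (addRow (N + 1) r z) := by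
  have hunion : patternsWith (N + 1) C r =
      ⋃ a ∈ (S : Set α), addRow (N + 1) r '' patternsWith N C (row a) := by
    ext z
    simp only [Set.mem_iUnion, exists_prop]
    constructor
    · intro hz
      obtain ⟨r', hr', z', hz', rfl⟩ := exists_addRow_eq hz
      obtain ⟨a, ha, rfl⟩ := (hS r').2 ⟨isRow_of_mem_patternsWith hz', hr'⟩
      exact ⟨a, ha, z', hz', rfl⟩
    · rintro ⟨a, ha, z', hz', rfl⟩
      exact addRow_mem_patternsWith hr ((hS _).1 ⟨a, ha, rfl⟩).2 hz'
  rw [hunion, finsum_mem_biUnion, finsum_mem_coe_finset]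
  · exact sum_congr rfl fun a _ =>
      finsum_mem_image ((addRow_injOn N r).mono fun z hz => hz.1)
  · intro a ha b hb hab
    refine Set.disjoint_left.2 ?_
    rintro _ ⟨z, hz, rfl⟩ ⟨z', hz', h⟩
    obtain rfl := addRow_injOn N r hz'.1 hz.1 h
    exact hab (hinj ha hb (hz.2.2.2.symm.trans hz'.2.2.2))
  · exact S.finite_toSet
  · exact fun a _ => (patternsWith_finite hC N _).image _

theorem patternsWith_zero (C : ℕ → ℕ → ℚ → Prop) : patternsWith 0 C 0 = {0} := by
  have not_idx : ∀ i j, ¬ Idx 0 i j := fun i j h => absurd (h.1.trans h.2.1) (by omega)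
  ext z
  refine ⟨fun hz => funext₂ fun i j => hz.1 i j (not_idx i j), ?_⟩
  rintro rfl
  exact ⟨fun _ _ _ => rfl, fun i j h => (not_idx i j h).elim,
    ⟨fun _ _ _ _ => le_rfl, fun _ _ _ _ => le_rfl⟩, rfl⟩

theorem rowSum_addRow_of_ne {N i : ℕ} (h : i ≠ N) (r : ℕ → ℚ) (z : ℕ → ℕ → ℚ) :
    rowSum (addRow N r z) i = rowSum z i := by
  simp only [rowSum, addRow, if_neg h]

/-! ### Rows of integers and half-integers -/

theorem isNonnegInt_add_half {a h : ℕ} (hh : h ≤ 1) : IsNonnegInt ((a : ℚ) + h / 2) ↔ h = 0 := by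
  constructor
  · rintro ⟨k, hk⟩
    have doubled : 2 * a + h = 2 * k := by
      have : 2 * (a : ℚ) + h = 2 * k := by linarith
      exact_mod_cast this
    omega
  · rintro rfl
    exact ⟨a, by simp⟩

theorem isNonnegHalfInt_add_half {a h : ℕ} (hh : h ≤ 1) :
    IsNonnegHalfInt ((a : ℚ) + h / 2) ↔ h = 1 := by
  constructor
  · rintro ⟨k, hk⟩
    have doubled : 2 * a + h = 2 * k + 1 := by
      have : 2 * (a : ℚ) + h = 2 * k + 1 := by linarith
      exact_mod_cast this
    omega
  · rintro rfl
    exact ⟨a, by simp⟩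

theorem isHalfNat_iff {q : ℚ} : IsHalfNat q ↔ ∃ k h : ℕ, h ≤ 1 ∧ q = k + h / 2 := by
  constructor
  · rintro ⟨a, rfl⟩
    refine ⟨a / 2, a % 2, by omega, ?_⟩
    have : (2 * (a / 2 : ℕ) + (a % 2 : ℕ) : ℚ) = a := by exact_mod_cast Nat.div_add_mod a 2
    linarith
  · rintro ⟨k, h, -, rfl⟩
    exact ⟨2 * k + h, by push_cast; ring⟩

theorem IsNonnegInt.not_isNonnegHalfInt {q : ℚ} (hq : IsNonnegInt q) : ¬ IsNonnegHalfInt q := by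
  obtain ⟨a, rfl⟩ := hq
  have := isNonnegHalfInt_add_half (a := a) zero_le_one
  simp_all

/-- The row `(λ_1 + h/2, …, λ_{l-1} + h/2, λ_l + h/2 - e/2)` of length `l`. For `h, e ∈ {0, 1}`
these are the rows of split orthogonal patterns: `h` says whether the typical entries are
half-integers, and `e` whether the last entry is atypical. -/
def halfRow (l h e : ℕ) (lam : ℕ →₀ ℕ) : ℕ → ℚ :=
  fun j => if 1 ≤ j ∧ j ≤ l then (lam (j - 1) : ℚ) + h / 2 - (if j = l then (e : ℚ) / 2 else 0)
    else 0

theorem halfRow_of_not {l h e : ℕ} {lam : ℕ →₀ ℕ} {j : ℕ} (hj : ¬ (1 ≤ j ∧ j ≤ l)) :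
    halfRow l h e lam j = 0 := if_neg hj

theorem halfRow_add_one {l h e : ℕ} {lam : ℕ →₀ ℕ} {i : ℕ} (hi : i < l) :
    halfRow l h e lam (i + 1) = lam i + h / 2 - if i + 1 = l then (e : ℚ) / 2 else 0 :=
  if_pos (by omega)

theorem halfRow_zero_add_one {l h : ℕ} {lam : ℕ →₀ ℕ} {i : ℕ} (hi : i < l) :
    halfRow l h 0 lam (i + 1) = lam i + h / 2 := by
  simp [halfRow_add_one hi]

theorem sum_halfRow {l h e : ℕ} {lam : ℕ →₀ ℕ} (hlam : LenLE (l + 1) lam) :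
    ∑ j ∈ Icc 1 (l + 1), halfRow (l + 1) h e lam j = lam.degree + (l + 1) * h / 2 - e / 2 := by
  rw [hlam.degree_eq, ← Ico_add_one_right_eq_Icc, sum_Ico_eq_sum_range]
  simp only [Nat.add_sub_cancel, add_comm 1]
  rw [sum_congr rfl fun i hi => halfRow_add_one (mem_range.1 hi)]
  simp [sum_sub_distrib, sum_add_distrib]
  ring

theorem sum_halfRow_zero {l h : ℕ} {lam : ℕ →₀ ℕ} (hlam : LenLE l lam) :
    ∑ j ∈ Icc 1 l, halfRow l h 0 lam j = lam.degree + l * h / 2 := by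
  cases l with
  | zero => simp [hlam.degree_eq]
  | succ l => simp [sum_halfRow hlam]

theorem halfRow_le_halfRow_iff {l l' h e e' i j : ℕ} (he : e ≤ 1) (he' : e' = 0 ∨ j + 1 < l')
    (hi : i < l) (hj : j < l') {lam lam' : ℕ →₀ ℕ} :
    halfRow l h e lam (i + 1) ≤ halfRow l' h e' lam' (j + 1) ↔ lam i ≤ lam' j := by
  have hlast : (if j + 1 = l' then (e' : ℚ) / 2 else 0) = 0 := by
    rcases he' with rfl | hj'
    · simp
    · exact if_neg hj'.ne
  obtain ⟨d, hd, hd_eq⟩ :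
      ∃ d : ℕ, d ≤ 1 ∧ (if i + 1 = l then (e : ℚ) / 2 else 0) = (d : ℚ) / 2 := by
    split_ifs
    · exact ⟨e, he, rfl⟩
    · exact ⟨0, zero_le_one, by simp⟩
  rw [halfRow_add_one hi, halfRow_add_one hj, hlast, hd_eq]
  have clear_denominators : (lam i : ℚ) + h / 2 - d / 2 ≤ lam' j + h / 2 - 0 ↔
      ((2 * lam i : ℕ) : ℚ) ≤ ((2 * lam' j + d : ℕ) : ℚ) := by
    push_cast
    constructor <;> intro <;> linarith
  rw [clear_denominators, Nat.cast_le]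
  omega

theorem halfRow_injective {l h e e' : ℕ} (he : e ≤ 1) (he' : e' ≤ 1) {lam lam' : ℕ →₀ ℕ}
    (hlam : LenLE (l + 1) lam) (hlam' : LenLE (l + 1) lam')
    (H : halfRow (l + 1) h e lam = halfRow (l + 1) h e' lam') : lam = lam' ∧ e = e' := by
  have last : lam l = lam' l ∧ e = e' := by
    have hl := congrFun H (l + 1)
    rw [halfRow_add_one (by omega), halfRow_add_one (by omega), if_pos rfl, if_pos rfl] at hl
    have hcast : ((2 * lam l + e' : ℕ) : ℚ) = (2 * lam' l + e : ℕ) := by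
      push_cast
      linarith
    have := Nat.cast_injective hcast
    omega
  refine ⟨Finsupp.ext fun i => ?_, last.2⟩
  rcases lt_or_ge i (l + 1) with hi | hi
  · have hi' := congrFun H (i + 1)
    rw [halfRow_add_one hi, halfRow_add_one hi, last.2] at hi'
    exact_mod_cast add_right_cancel (sub_left_injective hi')
  · rw [hlam i hi, hlam' i hi]

theorem halfRow_zero_injective {l h : ℕ} {lam lam' : ℕ →₀ ℕ} (hlam : LenLE l lam)
    (hlam' : LenLE l lam') (H : halfRow l h 0 lam = halfRow l h 0 lam') : lam = lam' := by
  cases l with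
  | zero => exact Finsupp.ext fun i => by rw [hlam i i.zero_le, hlam' i i.zero_le]
  | succ l => exact (halfRow_injective zero_le_one zero_le_one hlam hlam' H).1

theorem exists_halfRow_eq {l h e : ℕ} {r : ℕ → ℚ} (hr0 : ∀ j, ¬ (1 ≤ j ∧ j ≤ l) → r j = 0)
    (hr : ∀ j, 1 ≤ j → j ≤ l → ∃ k : ℕ, r j + (if j = l then (e : ℚ) / 2 else 0) = k + h / 2) :
    ∃ lam, LenLE l lam ∧ halfRow l h e lam = r := by
  choose! f hf using hr
  obtain ⟨lam, len, lam_eq⟩ := exists_lenLE_eq fun i : Fin l => f (i + 1)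
  refine ⟨lam, len, funext fun j => ?_⟩
  by_cases hj : 1 ≤ j ∧ j ≤ l
  · obtain ⟨i, rfl⟩ := Nat.exists_eq_add_of_le' hj.1
    rw [halfRow_add_one hj.2, sub_eq_iff_eq_add, hf _ hj.1 hj.2, lam_eq ⟨i, hj.2⟩]
  · rw [halfRow_of_not hj, hr0 j hj]

theorem idx_even_row {n j : ℕ} : Idx (2 * n) (2 * n) j ↔ 1 ≤ j ∧ j ≤ n := by
  unfold Idx
  omega

theorem idx_odd_row {n j : ℕ} : Idx (2 * n + 1) (2 * n + 1) j ↔ 1 ≤ j ∧ j ≤ n + 1 := by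
  unfold Idx
  omega

theorem interlaced_odd_halfRow_iff {n h e : ℕ} (he : e ≤ 1) {κ lam : ℕ →₀ ℕ}
    (hκ : LenLE (n + 1) κ) (hlam : LenLE (n + 1) lam) :
    Interlaced (2 * n + 1) (halfRow (n + 1) h e κ) (halfRow (n + 1) h 0 lam) ↔ HStrip κ lam := by
  simp only [Interlaced, idx_odd_row, show 2 * n + 1 + 1 = 2 * (n + 1) by ring, idx_even_row]
  constructor
  · intro H j
    rcases lt_or_ge j (n + 1) with hj | hj
    · have hH := H (j + 1) (by omega)
      refine ⟨?_, (halfRow_le_halfRow_iff he (Or.inl rfl) hj hj).1 hH.1⟩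
      rcases Nat.lt_or_ge (j + 1) (n + 1) with hj' | hj'
      · exact (halfRow_le_halfRow_iff zero_le_one (Or.inr hj') hj' hj).1 (hH.2 (by omega))
      · simp [hlam _ hj']
    · simp [hlam _ (hj.trans j.le_succ), hκ _ hj]
  · intro H j hj
    obtain ⟨i, rfl⟩ := Nat.exists_eq_add_of_le' hj.1
    exact ⟨(halfRow_le_halfRow_iff he (Or.inl rfl) hj.2 hj.2).2 (H i).2, fun hi =>
      (halfRow_le_halfRow_iff zero_le_one (Or.inr hi.2) hi.2 hj.2).2 (H i).1⟩

theorem interlaced_even_halfRow_iff {n h e : ℕ} (he : e ≤ 1) {μ κ : ℕ →₀ ℕ} (hμ : LenLE n μ)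
    (hκ : LenLE (n + 1) κ) :
    Interlaced (2 * n) (halfRow n h 0 μ) (halfRow (n + 1) h e κ) ↔ HStrip μ κ := by
  simp only [Interlaced, idx_odd_row, idx_even_row]
  constructor
  · intro H j
    rcases lt_or_ge j n with hj | hj
    · have hH := H (j + 1) (by omega)
      exact ⟨(halfRow_le_halfRow_iff he (Or.inl rfl) (by omega) hj).1 (hH.2 (by omega)),
        (halfRow_le_halfRow_iff zero_le_one (Or.inr (by omega)) hj (by omega)).1 hH.1⟩
    · simp [hμ _ hj, hκ _ (Nat.succ_le_succ hj)]
  · intro H j hj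
    obtain ⟨i, rfl⟩ := Nat.exists_eq_add_of_le' hj.1
    have hi : i < n := hj.2
    exact ⟨(halfRow_le_halfRow_iff zero_le_one (Or.inr (by omega)) hi (by omega)).2 (H i).2,
      fun _ => (halfRow_le_halfRow_iff he (Or.inl rfl) (by omega) hi).2 (H i).1⟩

theorem isRow_even_iff {C : ℕ → ℕ → ℚ → Prop} {n h : ℕ}
    (hC : ∀ j q, C (2 * n) j q ↔ ∃ k : ℕ, q = k + h / 2) {r : ℕ → ℚ} :
    IsRow (2 * n) C r ↔ ∃ lam, LenLE n lam ∧ halfRow n h 0 lam = r := by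
  simp only [IsRow, idx_even_row, hC]
  constructor
  · rintro ⟨hr, hr0⟩
    exact exists_halfRow_eq hr0 fun j hj hj' => by simpa using hr j ⟨hj, hj'⟩
  · rintro ⟨lam, -, rfl⟩
    refine ⟨fun j hj => ?_, fun j hj => halfRow_of_not hj⟩
    obtain ⟨i, rfl⟩ := Nat.exists_eq_add_of_le' hj.1
    exact ⟨lam i, halfRow_zero_add_one hj.2⟩

theorem finsum_patternsWith_odd {A : Type*} [AddCommMonoid A] {C : ℕ → ℕ → ℚ → Prop}
    (hC : ∀ i j q, C i j q → IsHalfNat q) {n h e : ℕ}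
    (hCn : ∀ j q, C (2 * n) j q ↔ ∃ k : ℕ, q = k + h / 2) (he : e ≤ 1) {κ : ℕ →₀ ℕ}
    (hκ : LenLE (n + 1) κ) (hrow : IsRow (2 * n + 1) C (halfRow (n + 1) h e κ))
    (f : (ℕ → ℕ → ℚ) → A) :
    ∑ᶠ z ∈ patternsWith (2 * n + 1) C (halfRow (n + 1) h e κ), f z =
      ∑ μ ∈ rowsAbove n κ, ∑ᶠ z ∈ patternsWith (2 * n) C (halfRow n h 0 μ),
        f (addRow (2 * n + 1) (halfRow (n + 1) h e κ) z) := by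
  refine finsum_patternsWith_succ hC hrow (rowsAbove n κ) _ ?_ (fun r' => ?_) f
  · exact fun μ hμ μ' hμ' =>
      halfRow_zero_injective (mem_rowsAbove.1 hμ).1 (mem_rowsAbove.1 hμ').1
  · rw [isRow_even_iff hCn]
    constructor
    · rintro ⟨μ, hμ, rfl⟩
      obtain ⟨hμ, hμκ⟩ := mem_rowsAbove.1 hμ
      exact ⟨⟨μ, hμ, rfl⟩, (interlaced_even_halfRow_iff he hμ hκ).2 hμκ⟩
    · rintro ⟨⟨μ, hμ, rfl⟩, hμκ⟩
      exact ⟨μ, mem_rowsAbove.2 ⟨hμ, (interlaced_even_halfRow_iff he hμ hκ).1 hμκ⟩, rfl⟩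

/-! ### Split orthogonal patterns -/

open Classical in
/-- The condition on the entry in position `(i, j)` of a split orthogonal pattern whose typical
entries lie in `ℤ + h/2`. -/
def soEntry (h i j : ℕ) (q : ℚ) : Prop :=
  if IsOddEnd i j then IsHalfNat q else ∃ k : ℕ, q = k + h / 2

theorem soEntry.isHalfNat {h i j : ℕ} {q : ℚ} (hq : soEntry h i j q) : IsHalfNat q := by
  unfold soEntry at hq
  split_ifs at hq
  · exact hq
  · obtain ⟨k, rfl⟩ := hq
    exact ⟨2 * k + h, by push_cast; ring⟩

theorem soEntry_even_iff {h n j : ℕ} {q : ℚ} :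
    soEntry h (2 * n) j q ↔ ∃ k : ℕ, q = k + h / 2 := by
  rw [soEntry, if_neg (by unfold IsOddEnd; omega)]

theorem isRow_odd_iff {n h : ℕ} (hh : h ≤ 1) {r : ℕ → ℚ} :
    IsRow (2 * n + 1) (soEntry h) r ↔
      ∃ κ e, LenLE (n + 1) κ ∧ e ≤ 1 ∧ e ≤ κ n + h ∧ halfRow (n + 1) h e κ = r := by
  have isOddEnd_iff : ∀ j, IsOddEnd (2 * n + 1) j ↔ j = n + 1 := fun j => by
    unfold IsOddEnd
    omega
  simp only [IsRow, idx_odd_row, soEntry, isOddEnd_iff]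
  constructor
  · rintro ⟨hr, hr0⟩
    obtain ⟨k, hk⟩ : IsHalfNat (r (n + 1)) := by simpa using hr (n + 1) (by omega)
    obtain ⟨e, a, he, hae⟩ : ∃ e a : ℕ, e ≤ 1 ∧ k + e = 2 * a + h :=
      ⟨(k + h) % 2, (k + (k + h) % 2 - h) / 2, by omega, by omega⟩
    have last : r (n + 1) + e / 2 = a + h / 2 := by
      have : ((k + e : ℕ) : ℚ) = (2 * a + h : ℕ) := congrArg _ hae
      push_cast at this
      rw [hk]
      linarith
    obtain ⟨κ, hκ, rfl⟩ := exists_halfRow_eq (e := e) hr0 fun j hj hj' => by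
      split_ifs with h'
      · exact ⟨a, h' ▸ last⟩
      · simpa [h'] using hr j ⟨hj, hj'⟩
    have hκa : κ n = a := by
      simpa [halfRow_add_one n.lt_succ_self] using last
    exact ⟨κ, e, hκ, he, by omega, rfl⟩
  · rintro ⟨κ, e, -, -, heκ, rfl⟩
    refine ⟨fun j hj => ?_, fun j hj => halfRow_of_not hj⟩
    obtain ⟨i, rfl⟩ := Nat.exists_eq_add_of_le' hj.1
    rw [halfRow_add_one hj.2]
    split_ifs with hi
    · obtain rfl : i = n := by omega
      refine ⟨2 * κ i + h - e, ?_⟩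
      rw [Nat.cast_sub (by omega)]
      push_cast
      ring
    · exact ⟨κ i, sub_zero _⟩

theorem hasShape_iff_eq_halfRow {N l h : ℕ} (hl : (N + 1) / 2 = l) {lam : ℕ →₀ ℕ}
    {z : ℕ → ℕ → ℚ} (hz : IsArray N z) :
    HasShape N (fun i : Fin l => (lam i : ℚ) + h / 2) z ↔ z N = halfRow l h 0 lam := by
  constructor
  · intro hshape
    funext j
    by_cases hj : 1 ≤ j ∧ j ≤ l
    · obtain ⟨i, rfl⟩ := Nat.exists_eq_add_of_le' hj.1
      rw [halfRow_zero_add_one hj.2]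
      exact hshape ⟨i, hj.2⟩
    · rw [halfRow_of_not hj]
      exact hz N j (by unfold Idx; omega)
  · intro hrow i
    rw [hrow, halfRow_zero_add_one i.2]

theorem soGT_eq_patternsWith {n h : ℕ} (hh : h ≤ 1) (lam : ℕ →₀ ℕ) :
    soGT n (fun i => (lam i : ℚ) + h / 2) =
      patternsWith (2 * n) (soEntry h) (halfRow n h 0 lam) := by
  ext z
  constructor
  · rintro ⟨hz0, hodd, htyp, hint, hshape⟩
    rw [hasShape_iff_eq_halfRow (by omega) hz0] at hshape
    refine ⟨hz0, fun i j hij => ?_, hint, hshape⟩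
    unfold soEntry
    split_ifs with hend
    · exact hodd i j hij hend
    have hn : 0 < n := by unfold Idx at hij; omega
    have corner : z (2 * n) 1 = lam 0 + h / 2 := by rw [hshape, halfRow_zero_add_one hn]
    have idx_corner : Idx (2 * n) (2 * n) 1 := idx_even_row.2 ⟨le_rfl, hn⟩
    have not_end_corner : ¬ IsOddEnd (2 * n) 1 := by unfold IsOddEnd; omega
    rcases htyp with htyp | htyp
    · have h_zero := htyp _ _ idx_corner not_end_corner
      rw [corner, isNonnegInt_add_half hh] at h_zero
      obtain ⟨k, hk⟩ := htyp i j hij hend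
      exact ⟨k, by simp [hk, h_zero]⟩
    · have h_one := htyp _ _ idx_corner not_end_corner
      rw [corner, isNonnegHalfInt_add_half hh] at h_one
      obtain ⟨k, hk⟩ := htyp i j hij hend
      exact ⟨k, by simp [hk, h_one]⟩
  · rintro ⟨hz0, hentry, hint, hrow⟩
    have typical : ∀ i j, Idx (2 * n) i j → ¬ IsOddEnd i j → ∃ k : ℕ, z i j = k + h / 2 :=
      fun i j hij hend => by simpa only [soEntry, hend, if_false] using hentry i j hij
    refine ⟨hz0, fun i j hij _ => (hentry i j hij).isHalfNat, ?_, hint,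
      (hasShape_iff_eq_halfRow (by omega) hz0).2 hrow⟩
    obtain rfl | rfl : h = 0 ∨ h = 1 := by omega
    · exact Or.inl fun i j hij hend => (typical i j hij hend).imp fun k hk => by simp [hk]
    · exact Or.inr fun i j hij hend => (typical i j hij hend).imp fun k hk => by simp [hk]

theorem finsum_patternsWith_even {A : Type*} [AddCommMonoid A] {n h : ℕ} (hh : h ≤ 1)
    {lam : ℕ →₀ ℕ} (hlam : LenLE (n + 1) lam) (f : (ℕ → ℕ → ℚ) → A) :
    ∑ᶠ z ∈ patternsWith (2 * n + 2) (soEntry h) (halfRow (n + 1) h 0 lam), f z =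
      ∑ κ ∈ rowsAbove (n + 1) lam, ∑ e ∈ range 2 with e ≤ κ n + h,
        ∑ᶠ z ∈ patternsWith (2 * n + 1) (soEntry h) (halfRow (n + 1) h e κ),
          f (addRow (2 * n + 2) (halfRow (n + 1) h 0 lam) z) := by
  rw [sum_sigma']
  refine finsum_patternsWith_succ (N := 2 * n + 1) (C := soEntry h)
    (fun _ _ _ => soEntry.isHalfNat)
    ((isRow_even_iff (n := n + 1) fun _ _ => soEntry_even_iff).2 ⟨lam, hlam, rfl⟩) _
    (fun a : (_ : ℕ →₀ ℕ) × ℕ => halfRow (n + 1) h a.2 a.1) ?_ (fun r' => ?_) f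
  · rintro ⟨κ, e⟩ hκ ⟨κ', e'⟩ hκ' H
    simp only [coe_sigma, Set.mem_sigma_iff, mem_coe, mem_filter, mem_range, mem_rowsAbove]
      at hκ hκ'
    obtain ⟨rfl, rfl⟩ := halfRow_injective (Nat.le_of_lt_succ hκ.2.1)
      (Nat.le_of_lt_succ hκ'.2.1) hκ.1.1 hκ'.1.1 H
    rfl
  · rw [isRow_odd_iff hh]
    simp only [Sigma.exists, mem_sigma, mem_filter, mem_range, mem_rowsAbove]
    constructor
    · rintro ⟨κ, e, ⟨⟨hκ, hκlam⟩, he, heκ⟩, rfl⟩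
      exact ⟨⟨κ, e, hκ, by omega, heκ, rfl⟩,
        (interlaced_odd_halfRow_iff (by omega) hκ hlam).2 hκlam⟩
    · rintro ⟨⟨κ, e, hκ, he, heκ, rfl⟩, hκlam⟩
      exact ⟨κ, e, ⟨⟨hκ, (interlaced_odd_halfRow_iff he hκ hlam).1 hκlam⟩, by omega, heκ⟩, rfl⟩

/-! ### Weights of patterns -/

section

variable (R : Type*) [CommRing R] {σ : Type*}

theorem vpow_zero (v : σ) : vpow R v 0 = 1 := by
  rw [vpow, Finsupp.single_zero, AddMonoidAlgebra.one_def]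

theorem vpow_add (v : σ) (p q : ℚ) : vpow R v (p + q) = vpow R v p * vpow R v q := by
  rw [vpow, vpow, vpow, AddMonoidAlgebra.single_mul_single, Finsupp.single_add, mul_one]

/-- The powers of a variable as a homomorphism. -/
def vpowHom (v : σ) : Multiplicative ℚ →* Poly R σ where
  toFun q := vpow R v q.toAdd
  map_one' := vpow_zero R v
  map_mul' p q := vpow_add R v p.toAdd q.toAdd

/-- A variable as a unit of the ring of Laurent polynomials. -/
def varUnit (v : σ) : (Poly R σ)ˣ :=
  (vpowHom R v).toHomUnits (Multiplicative.ofAdd 1)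

theorem val_varUnit_zpow (v : σ) (k : ℤ) :
    ((varUnit R v ^ k : (Poly R σ)ˣ) : Poly R σ) = vpow R v k := by
  rw [varUnit, ← map_zpow, MonoidHom.coe_toHomUnits, ← ofAdd_zsmul]
  simp [vpowHom]

theorem val_varUnit (v : σ) : (varUnit R v : Poly R σ) = vpow R v 1 := by
  simpa using val_varUnit_zpow R v 1

/-- The contribution of the last entry of the odd row `halfRow _ h e κ` to the weight of a split
orthogonal pattern, summed over the admissible `e`; here `c` is the last entry of `κ`, and the end
is atypical when `e = 1`. -/
def endWeight (h : ℕ) (β : R) (v : σ) (c : ℕ) : Poly R σ :=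
  ∑ e ∈ range 2 with e ≤ c + h, β ^ e • vpow R v (e - h / 2)

theorem endWeight_zero (β : R) : endWeight R 0 β = fun (v : σ) c =>
    if c = 0 then 1 else 1 + algebraMap R (Poly R σ) β * varUnit R v := by
  funext v c
  rw [endWeight, sum_filter, sum_range_succ, sum_range_one, val_varUnit]
  rcases Nat.eq_zero_or_pos c with rfl | hc
  · simp [vpow_zero]
  · simp [hc.ne', vpow_zero, Algebra.smul_def, Nat.succ_le_of_lt hc]
    rfl

theorem endWeight_zero_zero : endWeight R 0 (0 : R) = fun (_ : σ) _ => 1 := by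
  simp [endWeight_zero]

theorem endWeight_one (β : R) :
    endWeight R 1 β = fun (v : σ) _ => vpow R v (-1 / 2) + β • vpow R v (1 / 2) := by
  funext v c
  rw [endWeight, sum_filter, sum_range_succ, sum_range_one]
  norm_num

theorem rowKernelsCommute_endWeight {h : ℕ} (hh : h ≤ 1) (β : R) :
    RowKernelsCommute (varUnit R (σ := σ)) (endWeight R h β) := by
  obtain rfl | rfl : h = 0 ∨ h = 1 := by omega
  · rw [endWeight_zero]
    exact rowKernelsCommute_cb _ _
  · rw [endWeight_one]
    exact rowKernelsCommute_const _ _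

theorem weight_addRow {n N : ℕ} (hN : 2 * n < N) (x : Fin n → σ) (r : ℕ → ℚ) (z : ℕ → ℕ → ℚ) :
    weight R x (addRow N r z) = weight R x z := by
  unfold weight rowType
  refine prod_congr rfl fun i _ => ?_
  have := i.2
  repeat rw [rowSum_addRow_of_ne (by omega)]

theorem rowSum_addRow_self (N : ℕ) (r : ℕ → ℚ) (z : ℕ → ℕ → ℚ) :
    rowSum (addRow N r z) N = ∑ j ∈ Icc 1 ((N + 1) / 2), r j := by
  simp only [rowSum, addRow, if_true]

theorem weight_castSucc {n : ℕ} (x : Fin (n + 1) → σ) (z : ℕ → ℕ → ℚ) :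
    weight R x z = weight R (fun i => x i.castSucc) z * vpow R (x (Fin.last n))
      (rowSum z (2 * n + 2) - 2 * rowSum z (2 * n + 1) + rowSum z (2 * n)) := by
  rw [weight, Fin.prod_univ_castSucc]
  congr 2
  simp only [rowType, Fin.val_last, mul_add, mul_one, Nat.add_sub_cancel,
    show 2 * n + 2 - 1 = 2 * n + 1 from rfl]
  ring

theorem weight_addRow_addRow {n : ℕ} (x : Fin (n + 1) → σ) (r r' : ℕ → ℚ) (z : ℕ → ℕ → ℚ) :
    weight R x (addRow (2 * n + 2) r (addRow (2 * n + 1) r' z)) =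
      weight R (fun i => x i.castSucc) z * vpow R (x (Fin.last n))
        (∑ j ∈ Icc 1 (n + 1), r j - 2 * ∑ j ∈ Icc 1 (n + 1), r' j + rowSum z (2 * n)) := by
  rw [weight_castSucc, weight_addRow R (by omega), weight_addRow R (by omega), rowSum_addRow_self,
    rowSum_addRow_of_ne (by omega), rowSum_addRow_self, rowSum_addRow_of_ne (by omega),
    rowSum_addRow_of_ne (by omega), show (2 * n + 2 + 1) / 2 = n + 1 by omega,
    show (2 * n + 1 + 1) / 2 = n + 1 by omega]

end

open Classical in
/-- The number of atypical odd ends of a pattern with `2 * n` rows whose typical entries lie in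
`ℤ + h/2`. -/
def atypCountOf (h n : ℕ) (z : ℕ → ℕ → ℚ) : ℕ :=
  #{k ∈ Icc 1 n | ∃ a : ℕ, z (2 * k - 1) k = a + (1 - h) / 2}

theorem atypCount_eq_atypCountOf {n h : ℕ} (hh : h ≤ 1) {lam : ℕ →₀ ℕ} {z : ℕ → ℕ → ℚ}
    (hz : z (2 * n) = halfRow n h 0 lam) : atypCount n z = atypCountOf h n z := by
  classical
  refine congrArg card (filter_congr fun k hk => ?_)
  have hn : 0 < n := (mem_Icc.1 hk).1.trans (mem_Icc.1 hk).2
  have corner : z (2 * n) 1 = lam 0 + h / 2 := by rw [hz, halfRow_zero_add_one hn]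
  rw [IsAtypical, corner, isNonnegInt_add_half hh, isNonnegHalfInt_add_half hh]
  obtain rfl | rfl : h = 0 ∨ h = 1 := by omega
  · simp [IsNonnegHalfInt]
  · simp [IsNonnegInt]

theorem atypCountOf_addRow_addRow {n h e : ℕ} (he : e ≤ 1) {κ : ℕ →₀ ℕ} (heκ : e ≤ κ n + h)
    (r : ℕ → ℚ) (z : ℕ → ℕ → ℚ) :
    atypCountOf h (n + 1) (addRow (2 * n + 2) r (addRow (2 * n + 1) (halfRow (n + 1) h e κ) z)) =
      atypCountOf h n z + e := by
  classical
  have end_atypical_iff : (∃ a : ℕ, (κ n : ℚ) + h / 2 - e / 2 = a + (1 - h) / 2) ↔ e = 1 := by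
    constructor
    · rintro ⟨a, ha⟩
      have doubled : 2 * κ n + 2 * h = 2 * a + 1 + e := by
        have : 2 * (κ n : ℚ) + 2 * h = 2 * a + 1 + e := by linarith
        exact_mod_cast this
      omega
    · rintro rfl
      refine ⟨κ n + h - 1, ?_⟩
      push_cast [Nat.cast_sub heκ]
      ring
  rw [atypCountOf, atypCountOf, card_filter, card_filter, sum_Icc_succ_top (by omega)]
  congr 1
  · refine sum_congr rfl fun k hk => ?_
    have := mem_Icc.1 hk
    simp [addRow, show 2 * k - 1 ≠ 2 * n + 2 by omega, show 2 * k - 1 ≠ 2 * n + 1 by omega]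
  · rw [show 2 * (n + 1) - 1 = 2 * n + 1 by omega]
    simp only [addRow, show 2 * n + 1 ≠ 2 * n + 2 by omega, if_true, if_false,
      halfRow_add_one n.lt_succ_self, end_atypical_iff]
    interval_cases e <;> rfl

/-! ### Schur polynomials as sums over chains of rows -/

section

variable (R : Type*) [CommRing R] {σ : Type*}

theorem finsum_patternsWith_soEntry {h : ℕ} (hh : h ≤ 1) (β : R) (n : ℕ) (x : Fin n → σ)
    {lam : ℕ →₀ ℕ} (hlam : LenLE n lam) :
    ∑ᶠ z ∈ patternsWith (2 * n) (soEntry h) (halfRow n h 0 lam),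
      β ^ atypCountOf h n z • weight R x z =
    patternSum (varUnit R) (endWeight R h β) (List.ofFn x).reverse lam := by
  induction n generalizing lam with
  | zero =>
    have empty_row : halfRow 0 h 0 lam = 0 := funext fun j => halfRow_of_not (by omega)
    rw [empty_row, mul_zero, patternsWith_zero, finsum_mem_singleton]
    simp [patternSum, atypCountOf, weight]
  | succ n ih =>
    rw [List.ofFn_succ', List.concat_eq_append, List.reverse_append, List.reverse_singleton,
      List.singleton_append, patternSum_cons, List.length_reverse, List.length_ofFn, mul_add,
      mul_one, finsum_patternsWith_even hh hlam]
    refine sum_congr rfl fun κ hκ => ?_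
    have len_κ : LenLE (n + 1) κ := (mem_rowsAbove.1 hκ).1
    simp only [endWeight, mul_sum, sum_mul]
    rw [sum_comm]
    refine sum_congr rfl fun e he => ?_
    obtain ⟨he, heκ⟩ := mem_filter.1 he
    replace he : e ≤ 1 := Nat.le_of_lt_succ (mem_range.1 he)
    rw [finsum_patternsWith_odd (C := soEntry h) (fun _ _ _ => soEntry.isHalfNat)
      (fun _ _ => soEntry_even_iff) he len_κ ((isRow_odd_iff hh).2 ⟨κ, e, len_κ, he, heκ, rfl⟩)]
    refine sum_congr rfl fun μ hμ => ?_
    have len_μ : LenLE n μ := (mem_rowsAbove.1 hμ).1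
    rw [← ih (fun i => x i.castSucc) len_μ, mul_finsum_mem' _ _
      (patternsWith_finite (fun _ _ _ => soEntry.isHalfNat) _ _)]
    refine finsum_mem_congr rfl fun z hz => ?_
    have sum_μ : rowSum z (2 * n) = μ.degree + n * h / 2 := by
      rw [rowSum, hz.2.2.2, show (2 * n + 1) / 2 = n by omega, sum_halfRow_zero len_μ]
    rw [atypCountOf_addRow_addRow he heκ, weight_addRow_addRow, sum_halfRow_zero hlam,
      sum_halfRow len_κ, sum_μ, val_varUnit_zpow, mul_smul_comm, mul_smul_comm, ← vpow_add,
      smul_mul_assoc, smul_smul, ← pow_add, mul_comm (weight _ _ _)]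
    congr 3
    push_cast
    ring

theorem transCB_eq_patternSum {n h : ℕ} (hh : h ≤ 1) (x : Fin n → σ) (β : R) {lam : ℕ →₀ ℕ}
    (hlam : LenLE n lam) : transCB R (fun i => (lam i : ℚ) + h / 2) x β =
      patternSum (varUnit R) (endWeight R h β) (List.ofFn x) lam := by
  rw [transCB, soGT_eq_patternsWith hh,
    patternSum_perm (rowKernelsCommute_endWeight R hh β) (List.reverse_perm (List.ofFn x)).symm
      (by rwa [List.length_ofFn]), ← finsum_patternsWith_soEntry R hh β n x hlam]
  exact finsum_mem_congr rfl fun z hz => by rw [atypCount_eq_atypCountOf hh hz.2.2.2]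

theorem spGT_eq_setOf_atypCount_eq_zero {n : ℕ} {lam : Fin n → ℚ}
    (hlam : ∀ i, IsNonnegInt (lam i)) :
    spGT (2 * n) lam = {z | z ∈ soGT n lam ∧ atypCount n z = 0} := by
  ext z
  simp only [Set.mem_ofPred_eq, atypCount, card_eq_zero, filter_eq_empty_iff]
  constructor
  · rintro ⟨hz0, hentry, hint, hshape⟩
    refine ⟨⟨hz0, fun i j hij _ => (hentry i j hij).isHalfNat,
      Or.inl fun i j hij _ => hentry i j hij, hint, hshape⟩, ?_⟩
    have corner : ∀ k ∈ Icc 1 n, Idx (2 * n) (2 * n) 1 ∧ Idx (2 * n) (2 * k - 1) k := by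
      simp only [mem_Icc, Idx]
      omega
    rintro k hk (⟨-, hend⟩ | ⟨hcorner, -⟩)
    · exact (hentry _ _ (corner k hk).2).not_isNonnegHalfInt hend
    · exact (hentry _ _ (corner k hk).1).not_isNonnegHalfInt hcorner
  · rintro ⟨⟨hz0, hodd, htyp, hint, hshape⟩, htypical⟩
    refine ⟨hz0, fun i j hij => ?_, hint, hshape⟩
    have hn : 0 < n := by unfold Idx at hij; omega
    have corner : IsNonnegInt (z (2 * n) 1) := by
      have := hshape ⟨0, hn⟩
      simpa [this] using hlam ⟨0, hn⟩
    have idx_corner : Idx (2 * n) (2 * n) 1 := idx_even_row.2 ⟨le_rfl, hn⟩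
    have not_end_corner : ¬ IsOddEnd (2 * n) 1 := by unfold IsOddEnd; omega
    by_cases hend : IsOddEnd i j
    · obtain ⟨k, h, hh, hk⟩ := isHalfNat_iff.1 (hodd i j hij hend)
      have not_half : ¬ IsNonnegHalfInt (z i j) := fun hhalf => by
        have hi : i = 2 * j - 1 := by unfold IsOddEnd at hend; omega
        exact htypical (mem_Icc.2 (by unfold Idx at hij; omega)) (Or.inl ⟨corner, hi ▸ hhalf⟩)
      rw [hk, isNonnegHalfInt_add_half hh] at not_half
      rw [hk, isNonnegInt_add_half hh]
      omega
    · exact htyp.elim (fun htyp => htyp i j hij hend) fun htyp =>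
        (corner.not_isNonnegHalfInt (htyp _ _ idx_corner not_end_corner)).elim

theorem spEven_eq_transCB {n : ℕ} (x : Fin n → σ) {lam : Fin n → ℚ}
    (hlam : ∀ i, IsNonnegInt (lam i)) : spEven R lam x = transCB R lam x 0 := by
  rw [spEven, transCB, spGT_eq_setOf_atypCount_eq_zero hlam]
  refine finsum_congr fun z => ?_
  by_cases hz : z ∈ soGT n lam <;> by_cases hatyp : atypCount n z = 0 <;> simp [hz, hatyp]

theorem spEven_eq_patternSum {n : ℕ} (x : Fin n → σ) {lam : ℕ →₀ ℕ} (hlam : LenLE n lam) :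
    spEven R (fun i => (lam i : ℚ)) x =
      patternSum (varUnit R) (fun _ _ => 1) (List.ofFn x) lam := by
  rw [spEven_eq_transCB R x fun i => ⟨lam i, rfl⟩, ← endWeight_zero_zero,
    ← transCB_eq_patternSum R zero_le_one x 0 hlam]
  simp

theorem spGT_eq_patternsWith {N l : ℕ} (hl : (N + 1) / 2 = l) (lam : ℕ →₀ ℕ) :
    spGT N (fun i : Fin l => (lam i : ℚ)) =
      patternsWith N (fun _ _ => IsNonnegInt) (halfRow l 0 0 lam) := by
  ext z
  have shape_iff := hasShape_iff_eq_halfRow (h := 0) (lam := lam) (z := z) hl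
  simp only [Nat.cast_zero, zero_div, add_zero] at shape_iff
  exact and_congr_right fun hz0 => and_congr_right' (and_congr_right' (shape_iff hz0))

theorem spOdd_eq_oddPatternSum {n : ℕ} (x : Fin n → σ) (s : σ) {κ : ℕ →₀ ℕ}
    (hκ : LenLE (n + 1) κ) :
    spOdd R (fun i => (κ i : ℚ)) x s = oddPatternSum (varUnit R) (List.ofFn x) s κ := by
  have row_κ : IsRow (2 * n + 1) (fun _ _ => IsNonnegInt) (halfRow (n + 1) 0 0 κ) := by
    refine ⟨fun j hj => ?_, fun j hj => halfRow_of_not (idx_odd_row.not.1 hj)⟩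
    obtain ⟨i, rfl⟩ := Nat.exists_eq_add_of_le' hj.2.2.1
    exact ⟨κ i, by simp [halfRow_zero_add_one (idx_odd_row.1 hj).2]⟩
  rw [spOdd, spGT_eq_patternsWith (by omega), finsum_patternsWith_odd
    (fun _ _ _ => IsNonnegInt.isHalfNat) (fun _ _ => by simp [IsNonnegInt]) zero_le_one hκ row_κ,
    oddPatternSum, List.length_ofFn]
  refine sum_congr rfl fun μ hμ => ?_
  have len_μ : LenLE n μ := (mem_rowsAbove.1 hμ).1
  rw [← spEven_eq_patternSum R x len_μ, spEven, spGT_eq_patternsWith (by omega),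
    mul_finsum_mem' _ _ (patternsWith_finite (fun _ _ _ => IsNonnegInt.isHalfNat) _ _)]
  refine finsum_mem_congr rfl fun z hz => ?_
  have type_last : rowType (addRow (2 * n + 1) (halfRow (n + 1) 0 0 κ) z) (2 * n + 1) =
      κ.degree - μ.degree := by
    rw [rowType, Nat.add_sub_cancel, rowSum_addRow_self, rowSum_addRow_of_ne (by omega), rowSum,
      hz.2.2.2, show (2 * n + 1 + 1) / 2 = n + 1 by omega, show (2 * n + 1) / 2 = n by omega,
      sum_halfRow_zero hκ, sum_halfRow_zero len_μ]
    simp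
  rw [weight_addRow R (by omega), type_last, val_varUnit_zpow, mul_comm]
  push_cast
  rfl

end

/-! ### Subpartitions of a rectangle -/

theorem mem_subPartitions_rect {m h : ℕ} (hh : h ≤ 1) {k : ℕ} {lam : Fin m → ℚ} :
    lam ∈ subPartitions (rect m ((k : ℚ) + h / 2)) ↔
      Antitone lam ∧ ∀ i, ∃ a ≤ k, lam i = a + h / 2 := by
  have antitone_rect : Antitone (rect m ((k : ℚ) + h / 2)) := fun _ _ _ => le_rfl
  constructor
  · rintro ⟨⟨⟨-, rect_int⟩, anti, int⟩ | ⟨⟨-, rect_half⟩, anti, half⟩, le⟩ <;>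
      refine ⟨anti, fun i => ?_⟩
    · obtain rfl := (isNonnegInt_add_half hh).1 (rect_int i)
      obtain ⟨a, ha⟩ := int i
      exact ⟨a, by simpa [ha, rect] using le i, by simp [ha]⟩
    · obtain rfl := (isNonnegHalfInt_add_half hh).1 (rect_half i)
      obtain ⟨a, ha⟩ := half i
      exact ⟨a, by simpa [ha, rect] using le i, by simp [ha]⟩
  · rintro ⟨anti, entries⟩
    choose a ha lam_eq using entries
    refine ⟨?_, fun i => by simpa [lam_eq, rect] using ha i⟩
    obtain h_eq | h_eq : h = 0 ∨ h = 1 := by omega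
    · exact Or.inl ⟨⟨antitone_rect, fun _ => (isNonnegInt_add_half hh).2 h_eq⟩, anti,
        fun i => lam_eq i ▸ (isNonnegInt_add_half hh).2 h_eq⟩
    · exact Or.inr ⟨⟨antitone_rect, fun _ => (isNonnegHalfInt_add_half hh).2 h_eq⟩, anti,
        fun i => lam_eq i ▸ (isNonnegHalfInt_add_half hh).2 h_eq⟩

theorem antitone_add_half_iff {m h : ℕ} {lam : ℕ →₀ ℕ} (hlam : LenLE m lam) :
    Antitone (fun i : Fin m => (lam i : ℚ) + h / 2) ↔ Antitone lam := by
  constructor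
  · refine fun anti => antitone_nat_of_succ_le fun j => ?_
    rcases lt_or_ge (j + 1) m with hj | hj
    · simpa using anti (Fin.mk_le_mk.2 j.le_succ : (⟨j, by omega⟩ : Fin m) ≤ ⟨j + 1, hj⟩)
    · exact (hlam _ hj).trans_le zero_le
  · intro anti i j hij
    simpa using anti (Fin.le_def.1 hij)

theorem subPartitions_rect {m h : ℕ} (hh : h ≤ 1) (k : ℕ) :
    subPartitions (rect m ((k : ℚ) + h / 2)) =
      (fun (lam : ℕ →₀ ℕ) (i : Fin m) => (lam i : ℚ) + h / 2) ''
        {lam | lam ∈ rowBox m k ∧ Antitone lam} := by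
  ext f
  rw [mem_subPartitions_rect hh]
  constructor
  · rintro ⟨anti, entries⟩
    choose a ha f_eq using entries
    obtain ⟨lam, len, lam_eq⟩ := exists_lenLE_eq a
    obtain rfl : (fun i : Fin m => (lam i : ℚ) + h / 2) = f :=
      funext fun i => by rw [lam_eq, f_eq]
    refine ⟨lam, ⟨mem_rowBox.2 ⟨len, fun j => ?_⟩, (antitone_add_half_iff len).1 anti⟩, rfl⟩
    rcases lt_or_ge j m with hj | hj
    · exact (lam_eq ⟨j, hj⟩).trans_le (ha _)
    · exact (len j hj).trans_le zero_le
  · rintro ⟨lam, ⟨mem, anti⟩, rfl⟩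
    obtain ⟨len, le⟩ := mem_rowBox.1 mem
    exact ⟨(antitone_add_half_iff len).2 anti, fun i => ⟨lam i, le i, rfl⟩⟩

theorem finsum_subPartitions_rect {M : Type*} [AddCommMonoid M] {m h : ℕ} (hh : h ≤ 1) (k : ℕ)
    (F : (Fin m → ℚ) → M)
    (hF : ∀ lam ∈ rowBox m k, F (fun i => (lam i : ℚ) + h / 2) ≠ 0 → Antitone lam) :
    ∑ᶠ lam ∈ subPartitions (rect m ((k : ℚ) + h / 2)), F lam =
      ∑ lam ∈ rowBox m k, F (fun i => (lam i : ℚ) + h / 2) := by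
  classical
  rw [subPartitions_rect hh, finsum_mem_image, ← sum_filter_of_ne hF, ← finsum_mem_coe_finset,
    coe_filter]
  rintro lam ⟨mem, -⟩ lam' ⟨mem', -⟩ heq
  ext j
  rcases lt_or_ge j m with hj | hj
  · simpa using congrFun heq ⟨j, hj⟩
  · rw [(mem_rowBox.1 mem).1 j hj, (mem_rowBox.1 mem').1 j hj]

theorem rect_eq_preRow (m h k : ℕ) :
    rect m ((k : ℚ) + h / 2) = fun i : Fin m => (preRow m k 0 i : ℚ) + h / 2 :=
  funext fun i => by rw [preRow_apply_of_lt i.2, rect]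

theorem prependRect_eq_preRow {q m n : ℕ} (hn : n = q + m) (k h : ℕ) (lam : ℕ →₀ ℕ) :
    prependRect hn ((k : ℚ) + h / 2) (fun i : Fin m => (lam i : ℚ) + h / 2) =
      fun i : Fin n => (preRow q k lam i : ℚ) + h / 2 := by
  subst hn
  funext i
  rw [prependRect, Fin.cast_refl]
  refine Fin.addCases (fun i => ?_) (fun i => ?_) i
  · simp [rect, preRow_apply_of_lt]
  · simp

theorem lenLE_preRow_zero (q u : ℕ) : LenLE q (preRow q u 0) :=
  (lenLE_preRow_iff (p := 0)).2 fun _ _ => rfl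

/-! ### Sums over subpartitions of a rectangle -/

section

variable {A : Type*} [CommRing A] {σ : Type*} {U : σ → Aˣ} {l : List σ} {lam : ℕ →₀ ℕ}

theorem antitone_of_patternSum_ne_zero {g : σ → ℕ → A} (hlam : LenLE l.length lam)
    (h : patternSum U g l lam ≠ 0) : Antitone lam := by
  refine antitone_nat_of_succ_le fun j => ?_
  cases l with
  | nil => exact (hlam (j + 1) zero_le).trans_le zero_le
  | cons v l =>
    rw [patternSum_cons] at h
    obtain ⟨κ, hκ, -⟩ := exists_ne_zero_of_sum_ne_zero h
    have strip := (mem_rowsAbove.1 hκ).2 j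
    exact strip.1.trans strip.2

theorem antitone_of_oddPatternSum_ne_zero {s : σ} (h : oddPatternSum U l s lam ≠ 0) :
    Antitone lam := by
  obtain ⟨μ, hμ, -⟩ := exists_ne_zero_of_sum_ne_zero h
  exact antitone_nat_of_succ_le fun j =>
    ((mem_rowsAbove.1 hμ).2 j).1.trans ((mem_rowsAbove.1 hμ).2 j).2

end

section

variable (R : Type*) [CommRing R] {σ : Type*} {q m n : ℕ}

theorem transCB_rect_append (hn : n = q + m) (x : Fin n → σ) (y : Fin m → σ) (β : R) {u : ℚ}
    (hu : IsHalfNat u) :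
    transCB R (rect (n + m) u) (Fin.append x y) β =
      ∑ᶠ lam ∈ subPartitions (rect m u),
        transCB R (prependRect hn u lam) x β * transCB R lam y β := by
  obtain ⟨k, h, hh, rfl⟩ := isHalfNat_iff.1 hu
  have hc := rowKernelsCommute_endWeight R (σ := σ) hh β
  have split := patternSum_append_rect hc k q (List.ofFn y) (List.ofFn x) (by simpa using hn)
  rw [List.length_ofFn, List.length_ofFn, add_comm m n] at split
  rw [finsum_subPartitions_rect hh, rect_eq_preRow,
    transCB_eq_patternSum R hh _ _ (lenLE_preRow_zero _ _), List.ofFn_fin_append,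
    patternSum_perm hc List.perm_append_comm (by simpa using lenLE_preRow_zero _ _), split]
  · refine sum_congr rfl fun lam hlam => ?_
    have len := (mem_rowBox.1 hlam).1
    rw [prependRect_eq_preRow, transCB_eq_patternSum R hh _ _ (hn ▸ lenLE_preRow_iff.2 len),
      transCB_eq_patternSum R hh _ _ len]
  · intro lam hlam hne
    have len := (mem_rowBox.1 hlam).1
    have right_ne := right_ne_zero_of_mul hne
    rw [transCB_eq_patternSum R hh _ _ len] at right_ne
    exact antitone_of_patternSum_ne_zero (by rwa [List.length_ofFn]) right_ne

theorem soOdd_eq_transCB (lam : Fin n → ℚ) (x : Fin n → σ) :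
    soOdd R lam x = transCB R lam x 1 := by
  simp only [soOdd, transCB, one_pow, one_smul]

theorem spEven_rect_append (hn : n = q + m) (x : Fin n → σ) (y : Fin m → σ) (u : ℕ) :
    spEven R (rect (n + m) u) (Fin.append x y) =
      ∑ᶠ lam ∈ subPartitions (rect m u),
        spEven R (prependRect hn u lam) x * spEven R lam y := by
  rw [spEven_eq_transCB R _ (lam := rect (n + m) u) fun _ => ⟨u, rfl⟩,
    transCB_rect_append R hn x y 0 ⟨2 * u, by simp⟩]
  refine finsum_mem_congr rfl fun lam hlam => ?_
  have int : ∀ i, IsNonnegInt (lam i) := fun i => by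
    obtain ⟨a, -, ha⟩ := ((mem_subPartitions_rect (h := 0) zero_le_one).1 (by simpa using hlam)).2 i
    exact ⟨a, by simpa using ha⟩
  have int_prepend : ∀ i, IsNonnegInt (prependRect hn u lam i) := by
    subst hn
    exact Fin.addCases (fun i => ⟨u, by simp [prependRect, rect]⟩)
      fun i => by simpa [prependRect] using int i
  rw [spEven_eq_transCB R _ int, spEven_eq_transCB R _ int_prepend]

theorem ofFn_append_append_perm (x : Fin n → σ) (y : Fin m → σ) (s : σ) :
    (List.ofFn (Fin.append (Fin.append x y) ![s])).Perm (List.ofFn y ++ s :: List.ofFn x) := by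
  rw [List.ofFn_fin_append, List.ofFn_fin_append, List.append_assoc]
  exact List.perm_append_comm.trans (by simp)

theorem spEven_rect_append_append (hn : n + 1 = q + (m + 1)) (x : Fin n → σ) (y : Fin m → σ)
    (s : σ) (u : ℕ) :
    spEven R (rect (n + m + 1) u) (Fin.append (Fin.append x y) ![s]) =
      vpow R s (-u) *
        ∑ᶠ lam ∈ subPartitions (rect (m + 1) u),
          spOdd R (prependRect hn u lam) x s * spOdd R lam y s := by
  have rect_eq := rect_eq_preRow (n + m + 1) 0 u
  have sum_eq := fun F hF =>
    finsum_subPartitions_rect (M := Poly R σ) (m := m + 1) (h := 0) zero_le_one u F hF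
  have prepend_eq := prependRect_eq_preRow hn u 0
  simp only [Nat.cast_zero, zero_div, add_zero] at rect_eq sum_eq prepend_eq
  have split := patternSum_append_cons_rect (varUnit R) u q (List.ofFn y) (List.ofFn x) s
    (by rw [List.length_ofFn, List.length_ofFn]; omega)
  rw [List.length_ofFn, List.length_ofFn, add_comm m n] at split
  have vpow_eq : vpow R s (-u) = ((varUnit R s ^ (-u : ℤ) : (Poly R σ)ˣ) : Poly R σ) := by
    rw [val_varUnit_zpow, Int.cast_neg, Int.cast_natCast]
  rw [sum_eq, rect_eq, spEven_eq_patternSum R _ (lenLE_preRow_zero _ _),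
    patternSum_perm (rowKernelsCommute_const _ _) (ofFn_append_append_perm x y s)
      (by simpa using lenLE_preRow_zero _ _), split, vpow_eq]
  · refine congrArg _ (sum_congr rfl fun lam hlam => ?_)
    have len := (mem_rowBox.1 hlam).1
    rw [prepend_eq, spOdd_eq_oddPatternSum R _ _ (hn ▸ lenLE_preRow_iff.2 len),
      spOdd_eq_oddPatternSum R _ _ len]
  · intro lam hlam hne
    have right_ne := right_ne_zero_of_mul hne
    rw [spOdd_eq_oddPatternSum R _ _ (mem_rowBox.1 hlam).1] at right_ne
    exact antitone_of_oddPatternSum_ne_zero right_ne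

end

end CBSchur

end

open CBSchur in
theorem mainTheorem7 (R : Type*) [CommRing R] {σ : Type*} (n m : ℕ) (hm : 1 ≤ m) (hnm : m ≤ n)
    (x : Fin n → σ) (y : Fin m → σ) (s : σ) :
    (∀ (β : R) (u : ℚ), IsHalfNat u →
      transCB R (rect (n + m) u) (Fin.append x y) β =
        ∑ᶠ lam ∈ subPartitions (rect m u),
          transCB R (prependRect (Nat.sub_add_cancel hnm).symm u lam) x β * transCB R lam y β) ∧
    (∀ u : ℕ,
      spEven R (rect (n + m) u) (Fin.append x y) =
        ∑ᶠ lam ∈ subPartitions (rect m u),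
          spEven R (prependRect (Nat.sub_add_cancel hnm).symm u lam) x * spEven R lam y) ∧
    (∀ u : ℚ, IsHalfNat u →
      soOdd R (rect (n + m) u) (Fin.append x y) =
        ∑ᶠ lam ∈ subPartitions (rect m u),
          soOdd R (prependRect (Nat.sub_add_cancel hnm).symm u lam) x * soOdd R lam y) ∧
    (∀ u : ℕ,
      spEven R (rect (n + m + 1) u) (Fin.append (Fin.append x y) ![s]) =
        vpow R s (-u) *
          ∑ᶠ lam ∈ subPartitions (rect (m + 1) u),
            spOdd R (prependRect (k := n - m) (by omega) u lam) x s * spOdd R lam y s) := by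
  refine ⟨fun β u hu => transCB_rect_append R (Nat.sub_add_cancel hnm).symm x y β hu,
    fun u => spEven_rect_append R (Nat.sub_add_cancel hnm).symm x y u, fun u hu => ?_,
    fun u => spEven_rect_append_append R _ x y s u⟩
  simp only [soOdd_eq_transCB]
  exact transCB_rect_append R (Nat.sub_add_cancel hnm).symm x y 1 hu
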